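/- Consider a polling system with $N$ ONUs and $L\ge 1$ wavelengths (servers) in which any number of wavelengths may be present at an ONU simultaneously (each ONU has $L$ transmitters). ONU $i$ manages finitely many queues $(i,j)$ and has a switch overhead $\Delta_i>0$. When a wavelength starts a visit to ONU $i$, each queue $(i,j)$ receives a grant equal to its work that is present and not yet granted to another visit, but at most $d_{ij}>0$ (limited-gated service; work is measured in seconds of transmission on one wavelength). The wavelength transmits these grants one after the other at unit rate, then spends the overhead $\Delta_i$, and then starts its next visit. Queue $(i,j)$ receives work at a well-defined long-run rate $\rho_{ij}$, that is, the work received in $[0,t]$ divided by $t$ tends to the constant $\rho_{ij}$ almost surely; the initial queue contents and the start time and ONU of the first visit of each wavelength are arbitrary. Put $\rho=\sum_{i,j}\rho_{ij}$. Polling is either periodic (each wavelength visits all ONUs in its own fixed cyclic order) or random (after each visit the next ONU is chosen uniformly at random among all $N$ ONUs, the choices being independent). Call the system stable in law if the content of each queue stays bounded in probability as $t\to\infty$, and stable along sample paths if, almost surely, for each queue the long-run fraction of time that its content exceeds $K$ tends to $0$ as $K\to\infty$. Proposition. If the system is stable, in law or along sample paths, then $\rho<L$ and the mean time between successive visits of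 wavelengths to any given ONU is $$C=\frac{\Delta_1+\cdots+\Delta_N}{L-\rho}.$$ Precisely, for each ONU $i$ let $G_0,G_1,\dots$ be the times between successive visit starts, by any wavelengths, at ONU $i$. Then: 1. each $G_k$ is integrable and $\frac1m\sum_{k<m}G_k\to C$ in $L^1$; 2. if the $G_k$ are identically distributed (equilibrium), then $\mathbb E[G_0]=C$; 3. if the system is stable along sample paths, then $\frac1m\sum_{k<m}G_k\to C$ almost surely. This holds for both periodic and random polling. -/

import Mathlib

open MeasureTheory ProbabilityTheory Filter Topology

noncomputable section

/-- The static data of a polling system with `N` ONUs. ONU `i` manages `numQueues i` queues; queue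
`j` of ONU `i` may transmit for at most `maxGrant i j` seconds per wavelength visit, and each visit
to ONU `i` ends with a switch overhead of `overhead i` seconds. -/
structure PollingNetwork (N : ℕ) where
  numQueues : Fin N → ℕ
  maxGrant : ∀ i, Fin (numQueues i) → ℝ
  maxGrant_pos : ∀ i j, 0 < maxGrant i j
  overhead : Fin N → ℝ
  overhead_pos : ∀ i, 0 < overhead i

namespace PollingNetwork

/-- The inputs that drive one realization of the system with `L` wavelengths, on the time axis
`[0, ∞)`.

* `work i j t` is the initial content of queue `(i, j)` plus the work that arrives in `(0, t]`;
  work is measured in seconds of transmission on one wavelength.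
* `firstVisit l` is the time at which wavelength `l` starts its first visit.
* `route l k` is the ONU of the `k`-th visit of wavelength `l`, `k = 0, 1, 2, …`. -/
structure Input {N : ℕ} (S : PollingNetwork N) (L : ℕ) where
  work : ∀ i, Fin (S.numQueues i) → ℝ → ℝ
  work_nonneg : ∀ i j, 0 ≤ work i j 0
  work_mono : ∀ i j, MonotoneOn (work i j) (Set.Ici 0)
  firstVisit : Fin L → ℝ
  firstVisit_nonneg : ∀ l, 0 ≤ firstVisit l
  route : Fin L → ℕ → Fin N

/-- The state of the system just before the start of a visit: for each wavelength the time at which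
its next visit starts and the number of visits it has started already, and for each queue the total
work granted so far. -/
structure State {N : ℕ} (S : PollingNetwork N) (L : ℕ) where
  nextVisit : Fin L → ℝ
  visits : Fin L → ℕ
  granted : ∀ i, Fin (S.numQueues i) → ℝ

section Dynamics

variable {N L : ℕ} [NeZero L] {S : PollingNetwork N}

/-- The wavelengths whose next visit is the earliest form a nonempty set. -/
theorem State.earliest_nonempty (s : S.State L) :
    (Finset.univ.filter fun l => ∀ l', s.nextVisit l ≤ s.nextVisit l').Nonempty := by
  obtain ⟨l, hl⟩ := Finite.exists_min s.nextVisit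
  exact ⟨l, by simpa using hl⟩

/-- The wavelength that starts the next visit: the one with the earliest visit time (the smallest
index in case of a tie). -/
def State.wavelength (s : S.State L) : Fin L :=
  (Finset.univ.filter fun l => ∀ l', s.nextVisit l ≤ s.nextVisit l').min' s.earliest_nonempty

/-- The start time of the next visit. -/
def State.time (s : S.State L) : ℝ := s.nextVisit s.wavelength

/-- The ONU that receives the next visit. -/
def State.onu (s : S.State L) (x : S.Input L) : Fin N :=
  x.route s.wavelength (s.visits s.wavelength)

/-- The limited-gated grant of queue `(i, j)` for a visit to ONU `i` that starts now: all the work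
that is present and not yet granted to another visit, but no more than `maxGrant i j`. -/
def State.grant (s : S.State L) (x : S.Input L) (i : Fin N) (j : Fin (S.numQueues i)) : ℝ :=
  min (S.maxGrant i j) (x.work i j s.time - s.granted i j)

/-- One step of the evolution. The wavelength that starts a visit transmits the grants of all the
queues of the visited ONU, incurs the switch overhead of that ONU, and then starts its next
visit. -/
def State.step (x : S.Input L) (s : S.State L) : S.State L where
  nextVisit := Function.update s.nextVisit s.wavelength
    (s.time + ∑ j, s.grant x (s.onu x) j + S.overhead (s.onu x))
  visits := Function.update s.visits s.wavelength (s.visits s.wavelength + 1)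
  granted i j := s.granted i j + if s.onu x = i then s.grant x i j else 0

namespace Input

variable (x : S.Input L)

/-- The state just before the `n`-th visit of the whole system, `n = 0, 1, 2, …`; the visits of all
wavelengths to all ONUs are numbered together in the order of their start times. -/
def state (n : ℕ) : S.State L :=
  (State.step x)^[n] { nextVisit := x.firstVisit, visits := fun _ => 0, granted := fun _ _ => 0 }

/-- The start time of the `n`-th visit of the whole system. -/
def time (n : ℕ) : ℝ := (x.state n).time

/-- The ONU that receives the `n`-th visit of the whole system. -/
def onu (n : ℕ) : Fin N := (x.state n).onu x

/-- The work of queue `(i, j)` transmitted during the `n`-th visit up to time `t`. During a visit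
the queues of the ONU transmit their grants one after the other at unit rate. -/
def transmittedInVisit (n : ℕ) (i : Fin N) (j : Fin (S.numQueues i)) (t : ℝ) : ℝ :=
  if x.onu n = i then
    max 0 (min ((x.state n).grant x i j)
      (t - x.time n - ∑ j' ∈ Finset.univ.filter (fun j' => j' < j), (x.state n).grant x i j'))
  else 0

/-- The content of queue `(i, j)` at time `t`: the work that has arrived and has not been
transmitted (only the finitely many visits that start before `t` contribute to the sum). -/
def content (i : Fin N) (j : Fin (S.numQueues i)) (t : ℝ) : ℝ :=
  x.work i j t - ∑' n, x.transmittedInVisit n i j t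

/-- The start time of the `k`-th visit, by any wavelength, to ONU `i`, `k = 0, 1, 2, …`. -/
def visitTime (i : Fin N) (k : ℕ) : ℝ := x.time (Nat.nth (fun n => x.onu n = i) k)

/-- The time between the `k`-th and the next visit to ONU `i`. -/
def gap (i : Fin N) (k : ℕ) : ℝ := x.visitTime i (k + 1) - x.visitTime i k

end Input

end Dynamics

/-- A polling system with `L` wavelengths and random inputs. Queue `(i, j)` receives work at the
long-run rate `intensity i j`; nothing else is assumed about the traffic or the initial state. -/
structure System {N : ℕ} (S : PollingNetwork N) (L : ℕ) {Ω : Type*} [MeasurableSpace Ω]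
    (μ : Measure Ω) where
  input : Ω → S.Input L
  measurable_work : ∀ i j, Measurable fun p : Ω × ℝ => (input p.1).work i j p.2
  measurable_firstVisit : ∀ l, Measurable fun ω => (input ω).firstVisit l
  measurable_route : ∀ l k, Measurable fun ω => (input ω).route l k
  intensity : ∀ i, Fin (S.numQueues i) → ℝ
  tendsto_work : ∀ i j, ∀ᵐ ω ∂μ,
    Tendsto (fun t : ℝ => (input ω).work i j t / t) atTop (𝓝 (intensity i j))

namespace System

variable {N L : ℕ} {S : PollingNetwork N} {Ω : Type*} [MeasurableSpace Ω] {μ : Measure Ω}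

/-- The total traffic intensity `ρ`. -/
def load (X : S.System L μ) : ℝ := ∑ i, ∑ j, X.intensity i j

/-- Periodic polling: wavelength `l` visits the ONUs in the cyclic order `i, σ l i, σ l (σ l i), …`,
where `σ l` is a cyclic permutation of all the ONUs. -/
def IsPeriodic (X : S.System L μ) : Prop :=
  ∃ σ : Fin L → Equiv.Perm (Fin N), (∀ l, (σ l).IsCycleOn Set.univ) ∧
    ∀ᵐ ω ∂μ, ∀ l k, (X.input ω).route l (k + 1) = σ l ((X.input ω).route l k)

/-- Random polling: after each visit the next ONU is chosen uniformly at random among all ONUs, all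
choices being independent. The first ONU of each wavelength is arbitrary. -/
def IsRandom (X : S.System L μ) : Prop :=
  iIndepFun (fun (p : Fin L × ℕ) ω => (X.input ω).route p.1 (p.2 + 1)) μ ∧
    ∀ l k i, μ {ω | (X.input ω).route l (k + 1) = i} = (N : ENNReal)⁻¹

variable [NeZero L]

/-- Stability in law: the content of each queue stays bounded in probability as time grows. -/
def IsStableInLaw (X : S.System L μ) : Prop :=
  ∀ i j, ∀ ε : ENNReal, 0 < ε → ∃ K : ℝ, ∀ᶠ t : ℝ in atTop,
    μ {ω | K < (X.input ω).content i j t} ≤ ε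

/-- Stability along sample paths: almost surely, for each queue, the long-run fraction of time that
its content spends above the level `K` tends to `0` as `K → ∞`. -/
def IsStablePathwise (X : S.System L μ) : Prop :=
  ∀ i j, ∀ᵐ ω ∂μ, ∀ ε : ℝ, 0 < ε → ∃ K : ℝ, ∀ᶠ T : ℝ in atTop,
    volume {t : ℝ | t ∈ Set.Icc 0 T ∧ K < (X.input ω).content i j t} ≤ ENNReal.ofReal (ε * T)

/-- The average of the first `m` times between successive visits to ONU `i`. -/
def meanGap (X : S.System L μ) (i : Fin N) (m : ℕ) (ω : Ω) : ℝ :=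
  (∑ k ∈ Finset.range m, (X.input ω).gap i k) / m

end System

end PollingNetwork

end

/-! From its first start on, a wavelength is always transmitting or switching. So, up to an error
bounded in `t`, `L t` is the work granted by time `t` plus `∑ Δ_i V_i(t)`, where `V_i(t)` counts the
visits to ONU `i` started by `t` (`abs_balance_le`). Ungranted work is at most the content, so
stability makes it `o(t)` and the granted work is `ρ t + o(t)`. Each wavelength divides its visits
evenly among the ONUs, by cyclicity or by the strong law, so all `V_i(t)` agree up to `o(t)`. The
balance then forces `V_i(t) / t → (L - ρ) / ∑ Δ_i` (`IsRegular.tendsto_visitCount`). Visits have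
bounded duration, so this rate is positive, which is `ρ < L` (`IsRegular.sum_lt`). Inverting the
counts gives `C`.

Pathwise stability gives these limits almost surely. Stability in law gives a sublinear backlog only
in measure, hence almost surely along subsequences (`exists_subseq_tendsto_backlog`), and so
convergence of the averages in measure. To pass to `L¹`, note that a long wait for the `m`-th visit
means that some wavelength has neglected the ONU, which is exponentially unlikely
(`exists_routeCount_tail_bound`). Hence the integrals of the averages above a fixed level vanish
(`exists_lintegral_visitTime_le`). In equilibrium every average has mean `E[G_0]`, which must be the
limit. -/

noncomputable section

set_option linter.unusedSectionVars false

/-! ### Dynamics and busy-time balance of one realization -/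

namespace PollingNetwork

/-- An upper bound for the duration of a visit. -/
def maxDuration {N : ℕ} (S : PollingNetwork N) : ℝ :=
  ∑ i, (∑ j, S.maxGrant i j + S.overhead i)

theorem exists_overhead_lower_bound {N : ℕ} (S : PollingNetwork N) :
    ∃ δ > 0, ∀ i, δ ≤ S.overhead i := by
  rcases isEmpty_or_nonempty (Fin N) with h | h
  · exact ⟨1, one_pos, fun i => h.elim i⟩
  · obtain ⟨i, hi⟩ := Finite.exists_min S.overhead
    exact ⟨_, S.overhead_pos i, hi⟩

theorem sum_maxGrant_nonneg {N : ℕ} (S : PollingNetwork N) (i : Fin N) :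
    0 ≤ ∑ j, S.maxGrant i j :=
  Finset.sum_nonneg fun j _ => (S.maxGrant_pos i j).le

theorem visit_le_maxDuration {N : ℕ} (S : PollingNetwork N) (i : Fin N) :
    ∑ j, S.maxGrant i j + S.overhead i ≤ S.maxDuration :=
  Finset.single_le_sum (f := fun i => ∑ j, S.maxGrant i j + S.overhead i)
    (fun i _ => add_nonneg (S.sum_maxGrant_nonneg i) (S.overhead_pos i).le) (Finset.mem_univ i)

theorem maxDuration_pos {N : ℕ} (S : PollingNetwork N) (i : Fin N) : 0 < S.maxDuration :=
  (add_pos_of_nonneg_of_pos (S.sum_maxGrant_nonneg i) (S.overhead_pos i)).trans_le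
    (S.visit_le_maxDuration i)

variable {N L : ℕ} [NeZero L] {S : PollingNetwork N}

namespace State

theorem time_le (s : S.State L) (l : Fin L) : s.time ≤ s.nextVisit l := by
  have h := Finset.min'_mem _ s.earliest_nonempty
  rw [Finset.mem_filter] at h
  exact h.2 l

theorem grant_nonneg {s : S.State L} {x : S.Input L} {i : Fin N} {j : Fin (S.numQueues i)}
    (h : s.granted i j ≤ x.work i j s.time) : 0 ≤ s.grant x i j :=
  le_min (S.maxGrant_pos i j).le (sub_nonneg.2 h)

theorem grant_le_maxGrant (s : S.State L) (x : S.Input L) (i : Fin N) (j : Fin (S.numQueues i)) :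
    s.grant x i j ≤ S.maxGrant i j :=
  min_le_left _ _

/-- A grant never exceeds the ungranted work. The bound refers to the time of the current visit, not
of the next one, so that it yields a bound at every time in between. -/
theorem step_granted_le {s : S.State L} {x : S.Input L} {i : Fin N} {j : Fin (S.numQueues i)}
    (h : s.granted i j ≤ x.work i j s.time) :
    (s.step x).granted i j ≤ x.work i j s.time := by
  have h2 : s.grant x i j ≤ x.work i j s.time - s.granted i j := min_le_right _ _
  simp only [step]
  split_ifs <;> linarith

theorem time_le_step {s : S.State L} {x : S.Input L}
    (h : ∀ i j, s.granted i j ≤ x.work i j s.time) : s.time ≤ (s.step x).time := by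
  rw [time.eq_def (s.step x)]
  generalize (s.step x).wavelength = l
  simp only [step, Function.update_apply]
  split_ifs
  · have h1 : 0 ≤ ∑ j, s.grant x (s.onu x) j := Finset.sum_nonneg fun j _ => grant_nonneg (h _ j)
    have h2 := S.overhead_pos (s.onu x)
    linarith
  · exact s.time_le l

end State

namespace Input

variable (x : S.Input L)

theorem state_succ (n : ℕ) : x.state (n + 1) = (x.state n).step x := by
  simp only [state, Function.iterate_succ_apply']

/-- Both parts go through one induction: `work` is monotone only on `[0, ∞)`, and visit times
increase only because grants are nonnegative. -/
theorem state_invariant (n : ℕ) :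
    0 ≤ x.time n ∧ ∀ i j, (x.state n).granted i j ≤ x.work i j (x.time n) := by
  induction n with
  | zero =>
    have h : 0 ≤ x.time 0 := x.firstVisit_nonneg _
    exact ⟨h, fun i j => (x.work_nonneg i j).trans
      (x.work_mono i j (Set.mem_Ici.2 le_rfl) (Set.mem_Ici.2 h) h)⟩
  | succ n ih =>
    have h : x.time n ≤ x.time (n + 1) := by
      rw [time, time, state_succ]; exact State.time_le_step ih.2
    refine ⟨ih.1.trans h, fun i j => ?_⟩
    rw [state_succ]
    exact (State.step_granted_le (ih.2 i j)).trans
      (x.work_mono i j (Set.mem_Ici.2 ih.1) (Set.mem_Ici.2 (ih.1.trans h)) h)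

theorem time_nonneg (n : ℕ) : 0 ≤ x.time n := (x.state_invariant n).1

theorem grant_nonneg (n : ℕ) (i : Fin N) (j : Fin (S.numQueues i)) :
    0 ≤ (x.state n).grant x i j :=
  State.grant_nonneg ((x.state_invariant n).2 i j)

theorem granted_succ_le_work (n : ℕ) (i : Fin N) (j : Fin (S.numQueues i)) :
    (x.state (n + 1)).granted i j ≤ x.work i j (x.time n) := by
  rw [state_succ]
  exact State.step_granted_le ((x.state_invariant n).2 i j)

theorem monotone_time : Monotone x.time :=
  monotone_nat_of_le_succ fun n => by
    rw [time, time, state_succ]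
    exact State.time_le_step (x.state_invariant n).2

/-- The wavelength that makes the `n`-th visit. -/
def server (n : ℕ) : Fin L := (x.state n).wavelength

/-- The duration of the `n`-th visit, including the overhead. -/
def duration (n : ℕ) : ℝ := ∑ j, (x.state n).grant x (x.onu n) j + S.overhead (x.onu n)

theorem duration_le (n : ℕ) : x.duration n ≤ S.maxDuration :=
  (add_le_add_left (Finset.sum_le_sum fun j _ => State.grant_le_maxGrant _ _ _ j) _).trans
    (S.visit_le_maxDuration _)

theorem le_duration {δ : ℝ} (hδ : ∀ i, δ ≤ S.overhead i) (n : ℕ) : δ ≤ x.duration n :=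
  (hδ (x.onu n)).trans (le_add_of_nonneg_left (Finset.sum_nonneg fun j _ => x.grant_nonneg n _ j))

theorem nextVisit_succ (n : ℕ) (l : Fin L) :
    (x.state (n + 1)).nextVisit l =
      (x.state n).nextVisit l + if l = x.server n then x.duration n else 0 := by
  rw [state_succ]
  by_cases h : l = x.server n
  · subst h
    rw [if_pos rfl]
    exact (Function.update_self _ _ _).trans (add_assoc _ _ _)
  · rw [if_neg h, add_zero]
    exact Function.update_of_ne h _ _

theorem visits_succ (n : ℕ) (l : Fin L) :
    (x.state (n + 1)).visits l = (x.state n).visits l + if l = x.server n then 1 else 0 := by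
  rw [state_succ]
  by_cases h : l = x.server n
  · subst h
    simp only [State.step, server, Function.update_self, if_true]
  · rw [if_neg h, add_zero]
    exact Function.update_of_ne h _ _

theorem granted_succ (n : ℕ) (i : Fin N) (j : Fin (S.numQueues i)) :
    (x.state (n + 1)).granted i j =
      (x.state n).granted i j + if x.onu n = i then (x.state n).grant x i j else 0 := by
  rw [state_succ]; rfl

theorem sum_visits (n : ℕ) : ∑ l, (x.state n).visits l = n := by
  induction n with
  | zero => simp [state]
  | succ n ih => simp [visits_succ, Finset.sum_add_distrib, ih]

/-- The number of visits to ONU `i` among the first `n` visits of the whole system. -/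
def visitCount (i : Fin N) (n : ℕ) : ℕ := Nat.count (fun m => x.onu m = i) n

/-- The number of visits to ONU `i` among the first `k` visits of wavelength `l`. -/
def routeCount (l : Fin L) (i : Fin N) (k : ℕ) : ℕ := Nat.count (fun m => x.route l m = i) k

theorem monotone_routeCount (l : Fin L) (i : Fin N) : Monotone (x.routeCount l i) :=
  Nat.count_monotone _

/-- The interleaving of the wavelengths affects the counts only through the number of visits each
has made; this separates routing from queueing. -/
theorem visitCount_eq_sum (i : Fin N) (n : ℕ) :
    x.visitCount i n = ∑ l, x.routeCount l i ((x.state n).visits l) := by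
  induction n with
  | zero => simp [visitCount, routeCount, state]
  | succ n ih =>
    have h (l : Fin L) : x.routeCount l i ((x.state (n + 1)).visits l) =
        x.routeCount l i ((x.state n).visits l) +
          if l = x.server n then (if x.onu n = i then 1 else 0) else 0 := by
      rw [visits_succ]
      by_cases hl : l = x.server n
      · subst hl; simp only [if_true, routeCount, Nat.count_succ]; rfl
      · simp [hl]
    simp only [h, Finset.sum_add_distrib, ← ih, Finset.sum_ite_eq', Finset.mem_univ, if_true]
    simp only [visitCount, Nat.count_succ]

/-- The balance of busy time: every wavelength is either transmitting or switching. -/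
theorem sum_nextVisit (n : ℕ) :
    ∑ l, (x.state n).nextVisit l = ∑ l, x.firstVisit l + ∑ i, ∑ j, (x.state n).granted i j +
      ∑ i, S.overhead i * x.visitCount i n := by
  induction n with
  | zero => simp [visitCount, state]
  | succ n ih =>
    have h1 : ∑ i, ∑ j, (if x.onu n = i then (x.state n).grant x i j else 0) =
        ∑ j, (x.state n).grant x (x.onu n) j := by
      rw [Finset.sum_eq_single (x.onu n)]
      · simp
      · intro i _ hi; simp [hi.symm]
      · simp
    have h2 (i : Fin N) : S.overhead i * (x.visitCount i (n + 1) : ℝ) =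
        S.overhead i * x.visitCount i n + if x.onu n = i then S.overhead i else 0 := by
      simp only [visitCount, Nat.count_succ]
      split_ifs <;> push_cast <;> ring
    simp only [nextVisit_succ, granted_succ, h2, Finset.sum_add_distrib, h1, ih,
      Finset.sum_ite_eq, Finset.sum_ite_eq', Finset.mem_univ, if_true, duration]
    ring

theorem nextVisit_le (n : ℕ) (l : Fin L) :
    (x.state n).nextVisit l ≤ x.firstVisit l + S.maxDuration * (x.state n).visits l := by
  induction n with
  | zero => simp [state]
  | succ n ih =>
    rw [nextVisit_succ, visits_succ]
    have := x.duration_le n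
    split_ifs <;> push_cast <;> linarith

theorem visits_mul_le_nextVisit {δ : ℝ} (hδ : ∀ i, δ ≤ S.overhead i) (n : ℕ) (l : Fin L) :
    δ * (x.state n).visits l ≤ (x.state n).nextVisit l := by
  induction n with
  | zero => simpa [state] using x.firstVisit_nonneg l
  | succ n ih =>
    rw [nextVisit_succ, visits_succ]
    have := x.le_duration hδ n
    split_ifs <;> push_cast <;> linarith

theorem nextVisit_server (n : ℕ) : (x.state n).nextVisit (x.server n) = x.time n := rfl

/-- All visits of `l` but the last are over when the last one starts, at or before `t`; the last one
accounts for the extra `δ`. -/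
theorem visits_mul_le {δ t : ℝ} (hδ : ∀ i, δ ≤ S.overhead i) (hδ0 : 0 ≤ δ) (ht : 0 ≤ t) {n : ℕ}
    (h : ∀ m < n, x.time m ≤ t) (l : Fin L) : δ * (x.state n).visits l ≤ t + δ := by
  induction n with
  | zero => simpa [state] using add_nonneg ht hδ0
  | succ n ih =>
    rw [visits_succ]
    split_ifs with hl
    · have h1 := x.visits_mul_le_nextVisit hδ n l
      rw [hl, nextVisit_server] at h1
      have h2 := h n n.lt_succ_self
      subst hl
      push_cast; linarith
    · simpa using ih fun m hm => h m (hm.trans n.lt_succ_self)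

/-- The last visit overshoots `t` by at most its duration; the term `firstVisit` covers a wavelength
that has not started yet. -/
theorem nextVisit_le_of_time_le {t : ℝ} (ht : 0 ≤ t) {n : ℕ} (h : ∀ m < n, x.time m ≤ t)
    (l : Fin L) : (x.state n).nextVisit l ≤ t + S.maxDuration + x.firstVisit l := by
  have hD : 0 ≤ S.maxDuration := (S.maxDuration_pos (x.onu 0)).le
  induction n with
  | zero => simp only [state, Function.iterate_zero, id]; linarith
  | succ n ih =>
    rw [nextVisit_succ]
    split_ifs with hl
    · have h1 := x.duration_le n
      have h2 := h n n.lt_succ_self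
      have h3 := x.firstVisit_nonneg l
      subst hl
      rw [nextVisit_server]; linarith
    · simpa using ih fun m hm => h m (hm.trans n.lt_succ_self)

/-- Overheads bounded away from `0` exclude infinitely many visits in finite time. This makes
`started` the infimum of a nonempty set. -/
theorem exists_lt_time (t : ℝ) : ∃ n, t < x.time n := by
  by_contra! hc
  obtain ⟨δ, hδ0, hδ⟩ := S.exists_overhead_lower_bound
  have ht : 0 ≤ t := (x.time_nonneg 0).trans (hc 0)
  obtain ⟨n, hn⟩ := exists_nat_gt (L * (t + δ) / δ)
  rw [div_lt_iff₀ hδ0] at hn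
  have h1 : ∑ l, δ * ((x.state n).visits l : ℝ) ≤ ∑ _l : Fin L, (t + δ) :=
    Finset.sum_le_sum fun l _ => x.visits_mul_le hδ hδ0.le ht (fun m _ => hc m) l
  rw [← Finset.mul_sum, ← Nat.cast_sum, sum_visits] at h1
  simp at h1
  linarith

/-- The number of visits of the whole system that start in `[0, t]`. -/
def started (t : ℝ) : ℕ := sInf {n | t < x.time n}

theorem lt_time_started (t : ℝ) : t < x.time (x.started t) := Nat.sInf_mem (x.exists_lt_time t)

theorem time_le_of_lt_started {t : ℝ} {n : ℕ} (h : n < x.started t) : x.time n ≤ t :=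
  not_lt.1 (Nat.notMem_of_lt_sInf h)

theorem lt_time_of_started_le {t : ℝ} {n : ℕ} (h : x.started t ≤ n) : t < x.time n :=
  (x.lt_time_started t).trans_le (x.monotone_time h)

theorem monotone_started : Monotone x.started := fun s t h => by
  by_contra! hc
  exact ((x.lt_time_started t).trans_le (x.time_le_of_lt_started hc)).not_ge h

theorem granted_mono (i : Fin N) (j : Fin (S.numQueues i)) :
    Monotone fun n => (x.state n).granted i j :=
  monotone_nat_of_le_succ fun n => by
    rw [granted_succ]
    have := x.grant_nonneg n i j
    split_ifs <;> linarith

theorem granted_started_le_work {t : ℝ} (ht : 0 ≤ t) (i : Fin N) (j : Fin (S.numQueues i)) :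
    (x.state (x.started t)).granted i j ≤ x.work i j t := by
  rcases h : x.started t with _ | n
  · exact (x.work_nonneg i j).trans (x.work_mono i j (Set.mem_Ici.2 le_rfl) (Set.mem_Ici.2 ht) ht)
  · exact (x.granted_succ_le_work n i j).trans (x.work_mono i j (Set.mem_Ici.2 (x.time_nonneg n))
      (Set.mem_Ici.2 ht) (x.time_le_of_lt_started (by lia)))

/-- The work of queue `(i, j)` that has arrived by time `t` and has not been granted by then. -/
def backlog (i : Fin N) (j : Fin (S.numQueues i)) (t : ℝ) : ℝ :=
  x.work i j t - (x.state (x.started t)).granted i j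

theorem backlog_nonneg {t : ℝ} (ht : 0 ≤ t) (i : Fin N) (j : Fin (S.numQueues i)) :
    0 ≤ x.backlog i j t :=
  sub_nonneg.2 (x.granted_started_le_work ht i j)

theorem granted_eq_sum (n : ℕ) (i : Fin N) (j : Fin (S.numQueues i)) :
    (x.state n).granted i j =
      ∑ m ∈ Finset.range n, if x.onu m = i then (x.state m).grant x i j else 0 := by
  induction n with
  | zero => simp [state]
  | succ n ih => rw [granted_succ, ih, Finset.sum_range_succ]

/-- A visit transmits at most its grant, and nothing before it starts. This is the only link between
the stability assumptions and the grants. -/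
theorem backlog_le_content (i : Fin N) (j : Fin (S.numQueues i)) (t : ℝ) :
    x.backlog i j t ≤ x.content i j t := by
  unfold backlog content
  rw [tsum_eq_sum (s := Finset.range (x.started t)), granted_eq_sum]
  · refine sub_le_sub_left (Finset.sum_le_sum fun m _ => ?_) _
    unfold transmittedInVisit
    split_ifs
    · exact max_le (x.grant_nonneg m i j) (min_le_left _ _)
    · exact le_rfl
  · intro n hn
    have h1 := x.lt_time_of_started_le (not_lt.1 fun h => hn (Finset.mem_range.2 h))
    have h2 : 0 ≤ ∑ j' ∈ Finset.univ.filter (fun j' => j' < j), (x.state n).grant x i j' :=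
      Finset.sum_nonneg fun j _ => x.grant_nonneg n i j
    unfold transmittedInVisit
    split_ifs
    · exact max_eq_left ((min_le_right _ _).trans (by linarith))
    · rfl

theorem lt_started_visits (t : ℝ) (l : Fin L) :
    t < x.firstVisit l + S.maxDuration * (x.state (x.started t)).visits l :=
  (x.lt_time_started t).trans_le ((State.time_le _ l).trans (x.nextVisit_le _ l))

/-- Up to bounded errors, by time `t` each wavelength has spent all its time on visits. -/
theorem abs_balance_le {t : ℝ} (ht : 0 ≤ t) :
    |∑ i, ∑ j, (x.state (x.started t)).granted i j +
      ∑ i, S.overhead i * x.visitCount i (x.started t) - L * t| ≤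
      L * S.maxDuration + ∑ l, x.firstVisit l := by
  have h := x.sum_nextVisit (x.started t)
  -- Just after the last start up to `t`, each clock `nextVisit l` lies between `t` and `t +
  -- maxDuration + firstVisit l`.
  have h1 : ∑ _l : Fin L, t ≤ ∑ l, (x.state (x.started t)).nextVisit l :=
    Finset.sum_le_sum fun l _ => (x.lt_time_started t).le.trans (State.time_le _ l)
  have h2 : ∑ l, (x.state (x.started t)).nextVisit l ≤
      ∑ l, (t + S.maxDuration + x.firstVisit l) :=
    Finset.sum_le_sum fun l _ =>
      x.nextVisit_le_of_time_le ht (fun m hm => x.time_le_of_lt_started hm) l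
  have h3 : 0 ≤ ∑ l, x.firstVisit l := Finset.sum_nonneg fun l _ => x.firstVisit_nonneg l
  have h4 : 0 ≤ L * S.maxDuration := mul_nonneg L.cast_nonneg (S.maxDuration_pos (x.onu 0)).le
  simp [Finset.sum_add_distrib] at h1 h2
  rw [abs_le]
  constructor <;> nlinarith

theorem visitTime_le_of_lt_visitCount {i : Fin N} {k : ℕ} {t : ℝ}
    (h : k < x.visitCount i (x.started t)) : x.visitTime i k ≤ t :=
  x.time_le_of_lt_started (Nat.nth_lt_of_lt_count h)

/-- Without infinitely many visits, `Nat.nth` would take the default value `0` for large `k`. -/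
theorem lt_visitTime_of_visitCount_le {i : Fin N} (hi : {n | x.onu n = i}.Infinite) {k : ℕ} {t : ℝ}
    (h : x.visitCount i (x.started t) ≤ k) : t < x.visitTime i k :=
  x.lt_time_of_started_le (not_lt.1 fun h' => h.not_gt ((Nat.lt_nth_iff_count_lt hi).2 h'))

theorem monotone_visitTime {i : Fin N} (hi : {n | x.onu n = i}.Infinite) :
    Monotone (x.visitTime i) :=
  x.monotone_time.comp (Nat.nth_monotone hi)

/-- If every wavelength makes more than `k` of its first `n` visits to ONU `i`, then the time to
the `k`-th visit to this ONU, after the first start of a visit, is at most `n` visit durations. -/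
theorem visitTime_le {i : Fin N} {k n : ℕ} (h : ∀ l, k < x.routeCount l i n) :
    x.visitTime i k ≤ x.time 0 + S.maxDuration * n := by
  apply visitTime_le_of_lt_visitCount
  set t := x.time 0 + S.maxDuration * n
  -- The wavelength that starts first already makes `n` visits in this time. Which one it is depends
  -- on the realization, so `h` is required of all.
  have h1 := x.lt_started_visits t (x.server 0)
  have h2 : x.time 0 = x.firstVisit (x.server 0) := rfl
  have hD := S.maxDuration_pos i
  have h3 : n ≤ (x.state (x.started t)).visits (x.server 0) := by
    have : S.maxDuration * n < S.maxDuration * (x.state (x.started t)).visits (x.server 0) := by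
      simp only [t] at h1 ⊢; linarith
    exact_mod_cast (lt_of_mul_lt_mul_left this hD.le).le
  rw [visitCount_eq_sum]
  exact ((h (x.server 0)).trans_le (x.monotone_routeCount _ _ h3)).trans_le
    (Finset.single_le_sum (f := fun l => x.routeCount l i ((x.state (x.started t)).visits l))
      (fun _ _ => Nat.zero_le _) (Finset.mem_univ (x.server 0)))

end Input
end PollingNetwork

/-! ### Pathwise limits: visit rates and times between visits -/

namespace PollingNetwork
variable {N L : ℕ} [NeZero L] {S : PollingNetwork N}
namespace Input
variable (x : S.Input L)

theorem tendsto_visits (l : Fin L) :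
    Tendsto (fun t => (x.state (x.started t)).visits l) atTop atTop := by
  have hD := S.maxDuration_pos (x.onu 0)
  refine tendsto_natCast_atTop_iff (R := ℝ) |>.1 ?_
  have h : Tendsto (fun t => (t - x.firstVisit l) / S.maxDuration) atTop atTop :=
    (tendsto_atTop_add_const_right _ _ tendsto_id).atTop_div_const hD
  refine tendsto_atTop_mono (fun t => ?_) h
  rw [div_le_iff₀ hD]
  linarith [x.lt_started_visits t l]

variable {x}

/-- With `v` visits of `l` by time `t`, the quotient is `(routeCount / v - 1 / N) * (v / t)`. The
first factor vanishes and the second stays bounded; a single wavelength need not have a limiting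
visit rate. -/
theorem tendsto_routeCount_sub (l : Fin L) (i : Fin N)
    (h : Tendsto (fun n : ℕ => (x.routeCount l i n : ℝ) / n) atTop (𝓝 (N : ℝ)⁻¹)) :
    Tendsto (fun t : ℝ => ((x.routeCount l i ((x.state (x.started t)).visits l) : ℝ) -
      (x.state (x.started t)).visits l * (N : ℝ)⁻¹) / t) atTop (𝓝 0) := by
  obtain ⟨δ, hδ0, hδ⟩ := S.exists_overhead_lower_bound
  have h1 := (tendsto_iff_norm_sub_tendsto_zero.1 h).comp (x.tendsto_visits l)
  have h2 : Tendsto (fun t : ℝ => (1 + δ * t⁻¹) / δ) atTop (𝓝 ((1 + δ * 0) / δ)) :=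
    ((tendsto_inv_atTop_zero.const_mul δ).const_add 1).div_const δ
  have h3 := h1.mul h2
  rw [zero_mul] at h3
  refine squeeze_zero_norm' ?_ h3
  filter_upwards [eventually_gt_atTop 0, (x.tendsto_visits l).eventually_gt_atTop 0] with t ht hv
  have hb := x.visits_mul_le hδ hδ0.le ht.le (fun m hm => x.time_le_of_lt_started hm) l
  simp only [Function.comp]
  set v := (x.state (x.started t)).visits l
  have hv' : (0 : ℝ) < v := by exact_mod_cast hv
  have he : ((x.routeCount l i v : ℝ) - v * (N : ℝ)⁻¹) / t =
      ((x.routeCount l i v : ℝ) / v - (N : ℝ)⁻¹) * (v / t) := by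
    field_simp
  rw [he, norm_mul]
  refine mul_le_mul_of_nonneg_left ?_ (norm_nonneg _)
  rw [Real.norm_of_nonneg (by positivity), div_le_div_iff₀ ht hδ0]
  have : (1 + δ * t⁻¹) * t = t + δ := by field_simp
  rw [this]; linarith

theorem tendsto_visitCount_sub (i : Fin N)
    (h : ∀ l, Tendsto (fun n : ℕ => (x.routeCount l i n : ℝ) / n) atTop (𝓝 (N : ℝ)⁻¹)) :
    Tendsto (fun t : ℝ => (x.visitCount i (x.started t) : ℝ) / t -
      x.started t / t * (N : ℝ)⁻¹) atTop (𝓝 0) := by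
  have h1 := tendsto_finsetSum Finset.univ fun l _ => x.tendsto_routeCount_sub l i (h l)
  rw [Finset.sum_const_zero] at h1
  refine h1.congr fun t => ?_
  rw [← Finset.sum_div, Finset.sum_sub_distrib, ← Finset.sum_mul, ← Nat.cast_sum, ← Nat.cast_sum,
    sum_visits, ← visitCount_eq_sum]
  ring


/-- The regularity of the inputs that a realization satisfies almost surely: the queues receive work
at the rates `r`, and each wavelength visits the ONUs equally often. -/
structure IsRegular (x : S.Input L) (r : ∀ i, Fin (S.numQueues i) → ℝ) : Prop where
  work : ∀ i j, Tendsto (fun t : ℝ => x.work i j t / t) atTop (𝓝 (r i j))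
  route : ∀ l i, Tendsto (fun n : ℕ => (x.routeCount l i n : ℝ) / n) atTop (𝓝 (N : ℝ)⁻¹)

theorem tendsto_balance : Tendsto (fun t : ℝ =>
    ∑ i, ∑ j, (x.state (x.started t)).granted i j / t +
      ∑ i, S.overhead i * (x.visitCount i (x.started t) / t)) atTop (𝓝 L) := by
  rw [tendsto_iff_norm_sub_tendsto_zero]
  refine squeeze_zero' (Eventually.of_forall fun t => norm_nonneg _) ?_
    (tendsto_id.const_div_atTop (L * S.maxDuration + ∑ l, x.firstVisit l))
  filter_upwards [eventually_gt_atTop 0] with t ht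
  have h := x.abs_balance_le ht.le
  rw [id, le_div_iff₀ ht, Real.norm_eq_abs, ← abs_of_pos ht, ← abs_mul, abs_of_pos ht]
  refine le_of_eq_of_le (congrArg abs ?_) h
  rw [sub_mul, add_mul, Finset.sum_mul, Finset.sum_mul]
  congr 2
  · refine Finset.sum_congr rfl fun i _ => ?_
    rw [Finset.sum_mul]
    exact Finset.sum_congr rfl fun j _ => div_mul_cancel₀ _ ht.ne'
  · refine Finset.sum_congr rfl fun i _ => ?_
    field_simp

theorem sum_overhead_pos (x : S.Input L) : 0 < ∑ i, S.overhead i :=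
  Finset.sum_pos (fun i _ => S.overhead_pos i) ⟨x.onu 0, Finset.mem_univ _⟩

variable {r : ∀ i, Fin (S.numQueues i) → ℝ} {F : Filter ℝ}

/-- The overall rate of visits is determined by the balance of busy time along any filter of times
along which the backlog is sublinear. -/
theorem IsRegular.tendsto_started (hx : x.IsRegular r) (hF : F ≤ atTop)
    (hb : ∀ i j, Tendsto (fun t => x.backlog i j t / t) F (𝓝 0)) :
    Tendsto (fun t : ℝ => x.started t / t * (N : ℝ)⁻¹) F
      (𝓝 ((L - ∑ i, ∑ j, r i j) / ∑ i, S.overhead i)) := by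
  have h1 : Tendsto (fun t : ℝ => ∑ i, ∑ j, (x.state (x.started t)).granted i j / t) F
      (𝓝 (∑ i, ∑ j, r i j)) := by
    refine tendsto_finsetSum _ fun i _ => tendsto_finsetSum _ fun j _ => ?_
    have h := ((hx.work i j).mono_left hF).sub (hb i j)
    rw [sub_zero] at h
    refine h.congr fun t => ?_
    rw [backlog]; ring
  have h2 := ((tendsto_balance (x := x)).mono_left hF).sub h1
  have h3 := tendsto_finsetSum Finset.univ fun i _ =>
    ((x.tendsto_visitCount_sub i fun l => hx.route l i).mono_left hF).const_mul (S.overhead i)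
  -- Removing the granted work and the routing errors from the balance leaves `∑ Δ_i` times the
  -- common visit rate.
  have h4 := (h2.sub h3).div_const (∑ i, S.overhead i)
  simp only [mul_zero, Finset.sum_const_zero, sub_zero] at h4
  refine h4.congr fun t => ?_
  have hΔ := x.sum_overhead_pos
  rw [div_eq_iff hΔ.ne']
  simp only [mul_sub, Finset.sum_sub_distrib, ← Finset.sum_mul]
  ring

theorem IsRegular.tendsto_visitCount (hx : x.IsRegular r) (hF : F ≤ atTop)
    (hb : ∀ i j, Tendsto (fun t => x.backlog i j t / t) F (𝓝 0)) (i : Fin N) :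
    Tendsto (fun t : ℝ => (x.visitCount i (x.started t) : ℝ) / t) F
      (𝓝 ((L - ∑ i, ∑ j, r i j) / ∑ i, S.overhead i)) := by
  have h := ((x.tendsto_visitCount_sub i fun l => hx.route l i).mono_left hF).add
    (hx.tendsto_started hF hb)
  simpa using h

/-- Visits last at most `maxDuration`, so the limiting visit rate per ONU is at least `L /
(maxDuration * N) > 0`; this makes the inequality strict. -/
theorem IsRegular.sum_lt [F.NeBot] (hx : x.IsRegular r) (hF : F ≤ atTop)
    (hb : ∀ i j, Tendsto (fun t => x.backlog i j t / t) F (𝓝 0)) : ∑ i, ∑ j, r i j < L := by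
  have hD := S.maxDuration_pos (x.onu 0)
  have hL : (0 : ℝ) < L := by exact_mod_cast Nat.pos_of_ne_zero (NeZero.ne L)
  have hN : (0 : ℝ) < N := by exact_mod_cast (x.onu 0).pos
  have h1 : Tendsto (fun t : ℝ => (L - (∑ l, x.firstVisit l) / t) / S.maxDuration * (N : ℝ)⁻¹) F
      (𝓝 ((L - 0) / S.maxDuration * (N : ℝ)⁻¹)) :=
    (((tendsto_id.const_div_atTop _).mono_left hF).const_sub _).div_const _ |>.mul_const _
  have h2 := le_of_tendsto_of_tendsto h1 (hx.tendsto_started hF hb) (by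
    filter_upwards [hF (eventually_gt_atTop 0)] with t ht
    refine mul_le_mul_of_nonneg_right ?_ (by positivity)
    have h3 : ∑ _l : Fin L, t ≤
        ∑ l, (x.firstVisit l + S.maxDuration * (x.state (x.started t)).visits l) :=
      Finset.sum_le_sum fun l _ => (x.lt_started_visits t l).le
    rw [Finset.sum_add_distrib, ← Finset.mul_sum, ← Nat.cast_sum, sum_visits] at h3
    simp only [Finset.sum_const, Finset.card_univ, Fintype.card_fin, nsmul_eq_mul] at h3
    have h4 : L - (∑ l, x.firstVisit l) / t = (L * t - ∑ l, x.firstVisit l) / t := by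
      field_simp
    rw [h4, div_div, div_le_div_iff₀ (by positivity) ht]
    nlinarith)
  have h3 : 0 < (L - 0) / S.maxDuration * (N : ℝ)⁻¹ := by rw [sub_zero]; positivity
  have h4 := (div_pos_iff_of_pos_right x.sum_overhead_pos).1 (h3.trans_le h2)
  linarith

theorem IsRegular.tendsto_routeCount_atTop (hx : x.IsRegular r) (l : Fin L) (i : Fin N) :
    Tendsto (x.routeCount l i) atTop atTop := by
  have hN : (0 : ℝ) < (N : ℝ)⁻¹ := inv_pos.2 (by exact_mod_cast i.pos)
  have h := (hx.route l i).pos_mul_atTop hN tendsto_natCast_atTop_atTop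
  refine tendsto_natCast_atTop_iff (R := ℝ) |>.1 (h.congr' ?_)
  filter_upwards [eventually_gt_atTop 0] with n hn
  exact div_mul_cancel₀ _ (by exact_mod_cast hn.ne')

theorem IsRegular.infinite_visits (hx : x.IsRegular r) (i : Fin N) :
    {n | x.onu n = i}.Infinite := by
  intro hfin
  let l : Fin L := x.server 0
  obtain ⟨t, ht⟩ := (((hx.tendsto_routeCount_atTop l i).comp
    (x.tendsto_visits l)).eventually_gt_atTop hfin.toFinset.card).exists
  refine (ht.trans_le ?_).not_ge (Nat.count_le_card hfin (x.started t))
  have h := x.visitCount_eq_sum i (x.started t)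
  rw [visitCount] at h
  rw [h]
  exact Finset.single_le_sum (f := fun l => x.routeCount l i ((x.state (x.started t)).visits l))
    (fun _ _ => Nat.zero_le _) (Finset.mem_univ l)

/-- Rates of visits turn into mean times between visits. -/
theorem tendsto_visitTime_div {i : Fin N} {c : ℝ} (hc : 0 < c)
    (hi : {n | x.onu n = i}.Infinite)
    (h : Tendsto (fun t : ℝ => (x.visitCount i (x.started t) : ℝ) / t) atTop (𝓝 c)) :
    Tendsto (fun m : ℕ => x.visitTime i m / m) atTop (𝓝 c⁻¹) := by
  have hb (b : ℝ) (hb : 0 < b) :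
      Tendsto (fun m : ℕ => (x.visitCount i (x.started (b * m)) : ℝ) / (b * m)) atTop (𝓝 c) :=
    h.comp (tendsto_natCast_atTop_atTop.const_mul_atTop hb)
  refine tendsto_order.2 ⟨fun a ha => ?_, fun b hb' => ?_⟩
  -- As `c < b⁻¹`, fewer than `m` visits start by time `b * m` for large `m`, so visit `m` comes
  -- later. The upper bound is symmetric.
  · obtain ⟨b, hb1, hb2⟩ := exists_between (max_lt ha (inv_pos.2 hc))
    obtain ⟨hab, hb0⟩ := max_lt_iff.1 hb1
    filter_upwards [(hb b hb0).eventually (eventually_lt_nhds ((lt_inv_comm₀ hb0 hc).1 hb2)),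
      eventually_gt_atTop 0] with m hm hm0
    have hm0' : (0 : ℝ) < m := by exact_mod_cast hm0
    rw [div_lt_iff₀ (by positivity), inv_mul_cancel_left₀ hb0.ne'] at hm
    rw [lt_div_iff₀ hm0']
    exact (mul_lt_mul_of_pos_right hab hm0').trans
      (x.lt_visitTime_of_visitCount_le hi (by exact_mod_cast hm.le))
  · obtain ⟨a, ha1, ha2⟩ := exists_between hb'
    have ha0 : 0 < a := (inv_pos.2 hc).trans ha1
    filter_upwards [(hb a ha0).eventually (eventually_gt_nhds (inv_lt_of_inv_lt₀ hc ha1)),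
      eventually_gt_atTop 0] with m hm hm0
    have hm0' : (0 : ℝ) < m := by exact_mod_cast hm0
    rw [lt_div_iff₀ (by positivity), inv_mul_cancel_left₀ ha0.ne'] at hm
    rw [div_lt_iff₀ hm0']
    exact (x.visitTime_le_of_lt_visitCount (by exact_mod_cast hm)).trans_lt
      (mul_lt_mul_of_pos_right ha2 hm0')

/-- If the content of a queue is bounded most of the time then its backlog is sublinear. -/
theorem tendsto_backlog_div {i : Fin N} {j : Fin (S.numQueues i)} {ρ : ℝ}
    (hw : Tendsto (fun t : ℝ => x.work i j t / t) atTop (𝓝 ρ))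
    (h : ∀ ε : ℝ, 0 < ε → ∃ K : ℝ, ∀ᶠ T : ℝ in atTop,
      volume {t : ℝ | t ∈ Set.Icc 0 T ∧ K < x.content i j t} ≤ ENNReal.ofReal (ε * T)) :
    Tendsto (fun t => x.backlog i j t / t) atTop (𝓝 0) := by
  refine tendsto_order.2 ⟨fun a ha => ?_, fun e he => ?_⟩
  · filter_upwards [eventually_ge_atTop 0] with t ht
    exact ha.trans_le (div_nonneg (x.backlog_nonneg ht i j) ht)
  -- From a time in `[(1 - ε) T, T]` with content at most `K`, the backlog grows until `T` by at
  -- most the work received, about `ε ρ T`; `ε` is chosen to make this less than `e T`.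
  have hlim : Tendsto (fun ε : ℝ => ρ - (1 - ε) * ρ) (𝓝[>] 0) (𝓝 0) := by
    have : Continuous fun ε : ℝ => ρ - (1 - ε) * ρ := by fun_prop
    simpa using (this.tendsto 0).mono_left nhdsWithin_le_nhds
  obtain ⟨ε, hεe, hε0, hε1⟩ := ((hlim.eventually (eventually_lt_nhds he)).and
    (Ioo_mem_nhdsGT one_pos)).exists
  obtain ⟨K, hK⟩ := h (ε / 2) (by positivity)
  have h1 : Tendsto (fun T : ℝ => x.work i j ((1 - ε) * T) / ((1 - ε) * T)) atTop (𝓝 ρ) :=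
    hw.comp (tendsto_id.const_mul_atTop (by linarith))
  have h2 := (hw.sub (h1.const_mul (1 - ε))).add (tendsto_id.const_div_atTop K)
  rw [add_zero] at h2
  filter_upwards [h2.eventually (eventually_lt_nhds hεe), hK, eventually_gt_atTop 0]
    with T hT hvol hT0
  refine lt_of_le_of_lt ?_ hT
  -- The interval has length `ε T`, but content above `K` occupies at most `ε T / 2` of `[0, T]`.
  obtain ⟨t, ⟨ht1, ht2⟩, htK⟩ : ∃ t ∈ Set.Icc ((1 - ε) * T) T, x.content i j t ≤ K := by
    by_contra! hcon
    have hsub : Set.Icc ((1 - ε) * T) T ⊆ {t : ℝ | t ∈ Set.Icc 0 T ∧ K < x.content i j t} :=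
      fun t ht => ⟨⟨le_trans (by nlinarith) ht.1, ht.2⟩, hcon t ht⟩
    have hle := (measure_mono hsub).trans hvol
    rw [Real.volume_Icc, ENNReal.ofReal_le_ofReal_iff (by positivity)] at hle
    nlinarith
  have ht0 : 0 ≤ (1 - ε) * T := by nlinarith
  have hb := (x.backlog_le_content i j t).trans htK
  have hg : (x.state (x.started t)).granted i j ≤ (x.state (x.started T)).granted i j :=
    x.granted_mono i j (x.monotone_started ht2)
  have hwm := x.work_mono i j (Set.mem_Ici.2 ht0) (Set.mem_Ici.2 (ht0.trans ht1)) ht1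
  have he : x.work i j T / T - (1 - ε) * (x.work i j ((1 - ε) * T) / ((1 - ε) * T)) + K / id T =
      (x.work i j T - x.work i j ((1 - ε) * T) + K) / T := by
    have : 1 - ε ≠ 0 := by linarith
    simp only [id]
    field_simp
  rw [he]
  refine div_le_div_of_nonneg_right ?_ hT0.le
  unfold backlog at hb ⊢
  linarith

end Input
end PollingNetwork

/-! ### Routing frequencies for periodic and random polling -/

namespace PollingNetwork

section Cyclic

variable {N : ℕ} {σ : Equiv.Perm (Fin N)} {u : ℕ → Fin N}

/-- The route has period `N`, and each ONU occurs exactly once in its first period. -/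
theorem count_cyclic_add (hσ : σ.IsCycleOn Set.univ) (hu : ∀ k, u (k + 1) = σ (u k)) (i : Fin N)
    (k : ℕ) : Nat.count (fun m => u m = i) (N + k) = Nat.count (fun m => u m = i) k + 1 := by
  have hσ' : σ.IsCycleOn ((Finset.univ : Finset (Fin N)) : Set (Fin N)) := by simpa using hσ
  have hpow (k : ℕ) : u k = (σ ^ k) (u 0) := by
    induction k with
    | zero => simp
    | succ k ih => rw [hu, ih, pow_succ', Equiv.Perm.mul_apply]
  have hper (k : ℕ) : u (N + k) = u k := by
    have h := hσ'.pow_card_apply (Finset.mem_univ (u k))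
    rw [Finset.card_univ, Fintype.card_fin] at h
    rw [hpow (N + k), pow_add, Equiv.Perm.mul_apply, ← hpow, h]
  have hone : Nat.count (fun m => u m = i) N = 1 := by
    obtain ⟨m, hm, hmi⟩ := hσ'.exists_pow_eq (Finset.mem_univ (u 0)) (Finset.mem_univ i)
    rw [Finset.card_univ, Fintype.card_fin] at hm
    rw [Nat.count_eq_card_filter_range, Finset.card_eq_one]
    refine ⟨m, Finset.ext fun n => ?_⟩
    rw [Finset.mem_filter, Finset.mem_range, Finset.mem_singleton]
    constructor
    · rintro ⟨hn, hni⟩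
      rw [hpow, ← hmi] at hni
      have h := (hσ'.pow_apply_eq_pow_apply (Finset.mem_univ (u 0))).1 hni
      rw [Finset.card_univ, Fintype.card_fin] at h
      exact Nat.ModEq.eq_of_lt_of_lt h hn hm
    · rintro rfl
      exact ⟨hm, by rw [hpow, hmi]⟩
  rw [Nat.count_add, hone, add_comm]
  simp only [hper]

theorem count_cyclic (hσ : σ.IsCycleOn Set.univ) (hu : ∀ k, u (k + 1) = σ (u k)) (i : Fin N)
    (k : ℕ) : k / N ≤ Nat.count (fun m => u m = i) k ∧
      Nat.count (fun m => u m = i) k ≤ k / N + 1 := by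
  have hN : 0 < N := i.pos
  have hadd := count_cyclic_add hσ hu i
  have hmul (q r : ℕ) : Nat.count (fun m => u m = i) (N * q + r) =
      Nat.count (fun m => u m = i) r + q := by
    induction q with
    | zero => simp
    | succ q ih => rw [mul_add, mul_one, add_comm (N * q), add_assoc, hadd, ih, add_assoc]
  have h := hmul (k / N) (k % N)
  rw [Nat.div_add_mod] at h
  have h1 := Nat.count_monotone (fun m => u m = i) (Nat.mod_lt k hN).le
  have h2 := hadd 0
  simp only [add_zero, Nat.count_zero] at h2
  lia

theorem tendsto_count_cyclic (hσ : σ.IsCycleOn Set.univ) (hu : ∀ k, u (k + 1) = σ (u k))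
    (i : Fin N) :
    Tendsto (fun n : ℕ => (Nat.count (fun m => u m = i) n : ℝ) / n) atTop (𝓝 (N : ℝ)⁻¹) := by
  rw [tendsto_iff_norm_sub_tendsto_zero]
  refine squeeze_zero' (Eventually.of_forall fun n => norm_nonneg _) ?_
    (tendsto_const_div_atTop_nhds_zero_nat 1)
  filter_upwards [eventually_gt_atTop 0] with n hn
  obtain ⟨h1, h2⟩ := count_cyclic hσ hu i n
  have hn' : (0 : ℝ) < n := by exact_mod_cast hn
  have hN : (0 : ℝ) < N := by exact_mod_cast i.pos
  have h3 : (n : ℝ) / N < (n / N : ℕ) + 1 := by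
    rw [div_lt_iff₀ hN]
    exact_mod_cast (Nat.lt_mul_of_div_lt (Nat.lt_succ_self (n / N)) i.pos)
  have h4 : ((n / N : ℕ) : ℝ) ≤ n / N := Nat.cast_div_le
  have h1' : ((n / N : ℕ) : ℝ) ≤ Nat.count (fun m => u m = i) n := by exact_mod_cast h1
  have h2' : (Nat.count (fun m => u m = i) n : ℝ) ≤ (n / N : ℕ) + 1 := by exact_mod_cast h2
  have he : (Nat.count (fun m => u m = i) n : ℝ) / n - (N : ℝ)⁻¹ =
      ((Nat.count (fun m => u m = i) n : ℝ) - n / N) / n := by field_simp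
  rw [he, norm_div, Real.norm_of_nonneg hn'.le]
  refine div_le_div_of_nonneg_right (abs_le.2 ⟨?_, ?_⟩) hn'.le <;> linarith

end Cyclic

section Uniform

variable {N : ℕ} {Ω : Type*} [MeasurableSpace Ω] {μ : Measure Ω} [IsProbabilityMeasure μ]
  {U : ℕ → Ω → Fin N}

theorem integral_indicator_uniform {V : Ω → Fin N} (hV : Measurable V) (i : Fin N)
    (h : μ {ω | V ω = i} = (N : ENNReal)⁻¹) :
    ∫ ω, (if V ω = i then (1 : ℝ) else 0) ∂μ = (N : ℝ)⁻¹ := by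
  have hs : MeasurableSet {ω | V ω = i} := hV (measurableSet_singleton i)
  have he : (fun ω => if V ω = i then (1 : ℝ) else 0) = {ω | V ω = i}.indicator 1 := by
    ext ω; simp [Set.indicator_apply]
  rw [he, integral_indicator_one hs, Measure.real, h]
  simp

theorem tendsto_count_uniform (hU : ∀ k, Measurable (U k)) (hind : iIndepFun U μ)
    (huni : ∀ k i, μ {ω | U k ω = i} = (N : ENNReal)⁻¹) (i : Fin N) : ∀ᵐ ω ∂μ,
    Tendsto (fun n : ℕ => (∑ k ∈ Finset.range n, if U k ω = i then (1 : ℝ) else 0) / n) atTop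
      (𝓝 (N : ℝ)⁻¹) := by
  have hg : Measurable fun a : Fin N => if a = i then (1 : ℝ) else 0 := measurable_of_countable _
  rw [← integral_indicator_uniform (hU 0) i (huni 0 i)]
  refine strong_law_ae_real (fun k ω => if U k ω = i then (1 : ℝ) else 0) ?_ ?_ ?_
  · refine Integrable.of_bound (hg.comp (hU 0)).aestronglyMeasurable 1 (ae_of_all _ fun ω => ?_)
    split_ifs <;> simp
  · intro k m hkm
    exact (hind.indepFun hkm).comp hg hg
  · intro k
    have : IdentDistrib (U k) (U 0) μ μ := by
      refine ⟨(hU k).aemeasurable, (hU 0).aemeasurable, ?_⟩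
      refine Measure.ext_of_singleton fun a => ?_
      rw [Measure.map_apply (hU k) (measurableSet_singleton a),
        Measure.map_apply (hU 0) (measurableSet_singleton a)]
      exact (huni k a).trans (huni 0 a).symm
    exact this.comp hg

/-- Chernoff's bound for the number of visits to an ONU. -/
theorem measure_count_uniform_le (hU : ∀ k, Measurable (U k)) (hind : iIndepFun U μ)
    (huni : ∀ k i, μ {ω | U k ω = i} = (N : ENNReal)⁻¹) (i : Fin N) (m n : ℕ) :
    μ.real {ω | ∑ k ∈ Finset.range n, (if U k ω = i then (1 : ℝ) else 0) ≤ m} ≤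
      Real.exp 1 ^ m * (1 - (1 - Real.exp (-1)) * (N : ℝ)⁻¹) ^ n := by
  have hg : Measurable fun a : Fin N => if a = i then (1 : ℝ) else 0 := measurable_of_countable _
  let Y : ℕ → Ω → ℝ := fun k ω => if U k ω = i then (1 : ℝ) else 0
  have hY (k : ℕ) : Measurable (Y k) := hg.comp (hU k)
  have hYi : iIndepFun Y μ := hind.comp (fun _ a => if a = i then (1 : ℝ) else 0) fun _ => hg
  have hYint (k : ℕ) : Integrable (Y k) μ := by
    refine Integrable.of_bound (hY k).aestronglyMeasurable 1 (ae_of_all _ fun ω => ?_)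
    simp only [Y]; split_ifs <;> simp
  have hmgf (k : ℕ) : mgf (Y k) μ (-1) = 1 - (1 - Real.exp (-1)) * (N : ℝ)⁻¹ := by
    -- On the values `0` and `1` the exponential is affine, so the mean determines the moment
    -- generating function.
    have he (ω : Ω) : Real.exp (-1 * Y k ω) = 1 - (1 - Real.exp (-1)) * Y k ω := by
      simp only [Y]; split_ifs <;> simp
    simp only [mgf, he]
    rw [integral_sub (integrable_const _) ((hYint k).const_mul _), integral_const_mul,
      integral_indicator_uniform (hU k) i (huni k i)]
    simp
  have hS : (fun ω => ∑ k ∈ Finset.range n, (if U k ω = i then (1 : ℝ) else 0)) =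
      ∑ k ∈ Finset.range n, Y k := by ext ω; simp [Y]
  have hint : Integrable (fun ω => Real.exp (-1 * (∑ k ∈ Finset.range n, Y k) ω)) μ := by
    simp only [Finset.sum_apply]
    refine Integrable.of_bound (Real.measurable_exp.comp ((Finset.measurable_fun_sum _
      fun k _ => hY k).const_mul _)).aestronglyMeasurable 1 (ae_of_all _ fun ω => ?_)
    rw [Real.norm_of_nonneg (Real.exp_pos _).le, Real.exp_le_one_iff]
    have : 0 ≤ ∑ k ∈ Finset.range n, Y k ω :=
      Finset.sum_nonneg fun k _ => by simp only [Y]; split_ifs <;> simp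
    linarith
  have h := measure_le_le_exp_mul_mgf (μ := μ) (m : ℝ) (by norm_num : (-1 : ℝ) ≤ 0) hint
  rw [hYi.mgf_sum hY] at h
  simp only [hmgf, Finset.prod_const, Finset.card_range, neg_neg, one_mul] at h
  rw [← Real.exp_nat_mul, mul_one, ← hS] at *
  exact h

end Uniform

/-- This splits off the first ONU, which is arbitrary, from the later choices, which are independent
and uniform under random polling. -/
theorem Input.routeCount_succ {N L : ℕ} {S : PollingNetwork N} (x : S.Input L) (l : Fin L) (i : Fin N) (n : ℕ) :
    (x.routeCount l i (n + 1) : ℝ) = (∑ k ∈ Finset.range n, if x.route l (k + 1) = i then 1 else 0)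
      + if x.route l 0 = i then 1 else 0 := by
  rw [Input.routeCount, Nat.count_succ', Nat.count_eq_card_filter_range]
  simp

namespace System

variable {N L : ℕ} {S : PollingNetwork N} {Ω : Type*} [MeasurableSpace Ω] {μ : Measure Ω}
  [IsProbabilityMeasure μ] {X : S.System L μ}

theorem IsPeriodic.tendsto_routeCount (h : X.IsPeriodic) (l : Fin L) (i : Fin N) : ∀ᵐ ω ∂μ,
    Tendsto (fun n : ℕ => ((X.input ω).routeCount l i n : ℝ) / n) atTop (𝓝 (N : ℝ)⁻¹) := by
  obtain ⟨σ, hσ, h⟩ := h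
  filter_upwards [h] with ω hω
  exact tendsto_count_cyclic (hσ l) (hω l) i

theorem IsRandom.tendsto_routeCount (h : X.IsRandom) (l : Fin L) (i : Fin N) : ∀ᵐ ω ∂μ,
    Tendsto (fun n : ℕ => ((X.input ω).routeCount l i n : ℝ) / n) atTop (𝓝 (N : ℝ)⁻¹) := by
  have hinj : Function.Injective fun k : ℕ => (l, k) := fun a b hab => (Prod.mk.inj hab).2
  filter_upwards [tendsto_count_uniform (fun k => X.measurable_route l (k + 1))
    (h.1.precomp hinj) (fun k i => h.2 l k i) i] with ω hω
  rw [← tendsto_add_atTop_iff_nat 1]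
  have h1 := (hω.mul (tendsto_natCast_div_add_atTop (1 : ℝ))).add
    ((tendsto_const_div_atTop_nhds_zero_nat
      (if (X.input ω).route l 0 = i then (1 : ℝ) else 0)).comp (tendsto_add_atTop_nat 1))
  rw [mul_one, add_zero] at h1
  refine h1.congr' ?_
  filter_upwards [eventually_gt_atTop 0] with n hn
  have hn' : (n : ℝ) ≠ 0 := by exact_mod_cast hn.ne'
  simp only [Function.comp]
  rw [Input.routeCount_succ]
  push_cast
  field_simp

theorem tendsto_routeCount (h : X.IsPeriodic ∨ X.IsRandom) (l : Fin L) (i : Fin N) : ∀ᵐ ω ∂μ,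
    Tendsto (fun n : ℕ => ((X.input ω).routeCount l i n : ℝ) / n) atTop (𝓝 (N : ℝ)⁻¹) :=
  h.elim (fun h => h.tendsto_routeCount l i) fun h => h.tendsto_routeCount l i

/-- It is exponentially unlikely that a wavelength visits an ONU much less often than the
others. -/
theorem exists_routeCount_tail_bound (h : X.IsPeriodic ∨ X.IsRandom) : ∃ A B q : ℝ,
    0 < A ∧ 0 < B ∧ 0 < q ∧ q < 1 ∧ ∀ l i (m n : ℕ),
      μ.real {ω | (X.input ω).routeCount l i n ≤ m} ≤ A * B ^ m * q ^ n := by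
  rcases h with h | h
  · obtain ⟨σ, hσ, h⟩ := h
    -- The bound is `2 ^ (N * (m + 1)) / 2 ^ n`: at least `1` for `n < N * (m + 1)`, while for
    -- larger `n` the event is null because every `N` visits include `i`.
    refine ⟨2 ^ N, 2 ^ N, 1 / 2, by positivity, by positivity, by norm_num, by norm_num,
      fun l i m n => ?_⟩
    rcases lt_or_ge n (N * (m + 1)) with hn | hn
    · refine measureReal_le_one.trans ?_
      rw [one_div, inv_pow, ← div_eq_mul_inv, one_le_div (by positivity), ← pow_mul, ← pow_add]
      exact pow_le_pow_right₀ one_le_two (by lia)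
    · have h0 : μ {ω | (X.input ω).routeCount l i n ≤ m} = 0 := by
        refine measure_mono_null (fun ω hω => ?_) h
        intro hω'
        have h1 := (count_cyclic (hσ l) (hω' l) i n).1
        have h2 : m + 1 ≤ n / N := (Nat.le_div_iff_mul_le i.pos).2 (by lia)
        exact absurd (h2.trans h1) (not_le.2 (Nat.lt_succ_of_le hω))
      rw [Measure.real, h0, ENNReal.toReal_zero]
      positivity
  · rcases isEmpty_or_nonempty (Fin N) with hN | ⟨⟨i0⟩⟩
    · exact ⟨1, 1, 1 / 2, by norm_num, by norm_num, by norm_num, by norm_num, fun l i => hN.elim i⟩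
    have hN1 : (1 : ℝ) ≤ N := by exact_mod_cast i0.pos
    have hN0 : (0 : ℝ) < (N : ℝ)⁻¹ := by positivity
    have hN2 : (N : ℝ)⁻¹ ≤ 1 := inv_le_one_of_one_le₀ hN1
    have he0 := Real.exp_pos (-1)
    have he1 : Real.exp (-1) < 1 := by rw [Real.exp_lt_one_iff]; norm_num
    set q : ℝ := 1 - (1 - Real.exp (-1)) * (N : ℝ)⁻¹ with hq
    have hq0 : 0 < q := by nlinarith
    have hq1 : q < 1 := by nlinarith
    -- The factor `q⁻¹` compensates for the first visit, to which Chernoff's bound does not apply.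
    refine ⟨q⁻¹, Real.exp 1, q, inv_pos.2 hq0, Real.exp_pos 1, hq0, hq1, fun l i m n => ?_⟩
    rcases n with _ | n
    · refine measureReal_le_one.trans ?_
      rw [pow_zero, mul_one]
      exact one_le_mul_of_one_le_of_one_le ((one_le_inv₀ hq0).2 hq1.le)
        (one_le_pow₀ (Real.one_le_exp zero_le_one))
    · have hinj : Function.Injective fun k : ℕ => (l, k) := fun a b hab => (Prod.mk.inj hab).2
      have h1 := measure_count_uniform_le (fun k => X.measurable_route l (k + 1))
        (h.1.precomp hinj) (fun k i => h.2 l k i) i m n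
      have h2 : q⁻¹ * Real.exp 1 ^ m * q ^ (n + 1) = Real.exp 1 ^ m * q ^ n := by
        rw [pow_succ]; field_simp
      rw [h2]
      refine (measureReal_mono fun ω hω => ?_).trans h1
      have h3 := Input.routeCount_succ (X.input ω) l i n
      have h4 : ((X.input ω).routeCount l i (n + 1) : ℝ) ≤ m := by exact_mod_cast hω
      have h5 : (0 : ℝ) ≤ if (X.input ω).route l 0 = i then 1 else 0 := by split_ifs <;> simp
      simp only [Set.mem_ofPred_eq]
      linarith

end System
end PollingNetwork

/-! ### Measurability of states, counts and visit times -/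

theorem measurable_apply_of_countable {Ω α β : Type*} [MeasurableSpace Ω] [MeasurableSpace α]
    [MeasurableSpace β] [Countable α] [MeasurableSingletonClass α] {f : α → Ω → β} {g : Ω → α}
    (hf : ∀ a, Measurable (f a)) (hg : Measurable g) : Measurable fun ω => f (g ω) ω :=
  (measurable_from_prod_countable_right (f := fun p : α × Ω => f p.1 p.2) hf).comp
    (hg.prodMk measurable_id)

theorem measurable_sInf_nat {Ω : Type*} [MeasurableSpace Ω] {p : ℕ → Ω → Prop}
    (hp : ∀ n, MeasurableSet {ω | p n ω}) : Measurable fun ω => sInf {n | p n ω} := by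
  refine measurable_to_countable' fun m => ?_
  -- The second set accounts for the default `sInf ∅ = 0`.
  have h : (fun ω => sInf {n | p n ω}) ⁻¹' {m} =
      ({ω | p m ω} ∩ ⋂ k, ⋂ (_ : k < m), {ω | p k ω}ᶜ) ∪
        ({_ω | m = 0} ∩ ⋂ k, {ω | p k ω}ᶜ) := by
    ext ω
    simp only [Set.mem_preimage, Set.mem_singleton_iff, Set.mem_union, Set.mem_inter_iff,
      Set.mem_ofPred_eq, Set.mem_iInter, Set.mem_compl_iff]
    constructor
    · rintro rfl
      rcases Set.eq_empty_or_nonempty {n | p n ω} with he | hne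
      · exact Or.inr ⟨by rw [he, Nat.sInf_empty], fun k hk => (he ▸ hk : k ∈ (∅ : Set ℕ)).elim⟩
      · exact Or.inl ⟨Nat.sInf_mem hne, fun k hk => Nat.notMem_of_lt_sInf hk⟩
    · rintro (⟨hm, hk⟩ | ⟨rfl, hk⟩)
      · exact le_antisymm (Nat.sInf_le hm)
          (le_csInf ⟨m, hm⟩ fun n hn => not_lt.1 fun hlt => hk n hlt hn)
      · rw [show {n | p n ω} = ∅ from Set.eq_empty_of_forall_notMem hk, Nat.sInf_empty]
  rw [h]
  exact ((hp m).inter (MeasurableSet.iInter fun k => MeasurableSet.iInter fun _ => (hp k).compl)).union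
    ((MeasurableSet.const _).inter (MeasurableSet.iInter fun k => (hp k).compl))

namespace PollingNetwork
variable {N L : ℕ} [NeZero L] {S : PollingNetwork N} {Ω : Type*} [MeasurableSpace Ω]

theorem State.wavelength_eq_iff (s : S.State L) (l : Fin L) : s.wavelength = l ↔
    (∀ l', s.nextVisit l ≤ s.nextVisit l') ∧
      ∀ k < l, ¬ ∀ l', s.nextVisit k ≤ s.nextVisit l' := by
  have hmem : ∀ k, k ∈ (Finset.univ.filter fun l => ∀ l', s.nextVisit l ≤ s.nextVisit l') ↔
      ∀ l', s.nextVisit k ≤ s.nextVisit l' := fun k => by simp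
  constructor
  · rintro rfl
    exact ⟨(hmem _).1 (Finset.min'_mem _ s.earliest_nonempty), fun k hk h =>
      (Finset.min'_le _ _ ((hmem k).2 h)).not_gt hk⟩
  · rintro ⟨h1, h2⟩
    refine le_antisymm (Finset.min'_le _ _ ((hmem l).2 h1)) (not_lt.1 fun hlt => ?_)
    exact h2 _ hlt ((hmem _).1 (Finset.min'_mem _ s.earliest_nonempty))

theorem State.measurable_wavelength {s : Ω → S.State L}
    (hs : ∀ l, Measurable fun ω => (s ω).nextVisit l) : Measurable fun ω => (s ω).wavelength := by
  have hm (l : Fin L) : MeasurableSet {ω | ∀ l', (s ω).nextVisit l ≤ (s ω).nextVisit l'} := by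
    rw [Set.ofPred_forall]
    exact MeasurableSet.iInter fun l' => measurableSet_le (hs l) (hs l')
  refine measurable_to_countable' fun l => ?_
  have h : (fun ω => (s ω).wavelength) ⁻¹' {l} =
      {ω | ∀ l', (s ω).nextVisit l ≤ (s ω).nextVisit l'} ∩
        ⋂ k, ⋂ (_ : k < l), {ω | ∀ l', (s ω).nextVisit k ≤ (s ω).nextVisit l'}ᶜ := by
    ext ω
    simp only [Set.mem_preimage, Set.mem_singleton_iff, State.wavelength_eq_iff,
      Set.mem_inter_iff, Set.mem_iInter, Set.mem_compl_iff, Set.mem_ofPred_eq]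
  rw [h]
  exact (hm l).inter (MeasurableSet.iInter fun k => MeasurableSet.iInter fun _ => (hm k).compl)

namespace System
variable {μ : Measure Ω} (X : S.System L μ)

/-- The measurability of the components of the state. -/
structure MeasurableState (n : ℕ) : Prop where
  nextVisit : ∀ l, Measurable fun ω => ((X.input ω).state n).nextVisit l
  visits : ∀ l, Measurable fun ω => ((X.input ω).state n).visits l
  granted : ∀ i j, Measurable fun ω => ((X.input ω).state n).granted i j

variable {X}

theorem MeasurableState.server {n : ℕ} (h : X.MeasurableState n) :
    Measurable fun ω => (X.input ω).server n :=
  State.measurable_wavelength h.nextVisit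

theorem MeasurableState.time {n : ℕ} (h : X.MeasurableState n) :
    Measurable fun ω => (X.input ω).time n :=
  measurable_apply_of_countable h.nextVisit h.server

theorem MeasurableState.onu {n : ℕ} (h : X.MeasurableState n) :
    Measurable fun ω => (X.input ω).onu n :=
  measurable_apply_of_countable (f := fun l ω => (X.input ω).route l ((X.input ω).state n |>.visits l))
    (fun l => measurable_apply_of_countable (X.measurable_route l) (h.visits l)) h.server

/-- The work is evaluated at a random time, which is why joint measurability in `(ω, t)` is assumed.
-/
theorem MeasurableState.grant {n : ℕ} (h : X.MeasurableState n) (i : Fin N)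
    (j : Fin (S.numQueues i)) : Measurable fun ω => ((X.input ω).state n).grant (X.input ω) i j :=
  measurable_const.min (((X.measurable_work i j).comp (measurable_id.prodMk h.time)).sub
    (h.granted i j))

variable (X)

theorem measurableState (n : ℕ) : X.MeasurableState n := by
  induction n with
  | zero => exact ⟨X.measurable_firstVisit, fun _ => measurable_const, fun _ _ => measurable_const⟩
  | succ n h =>
    have hs (l : Fin L) : MeasurableSet {ω | l = (X.input ω).server n} := by
      simp only [eq_comm (a := l)]
      exact h.server (measurableSet_singleton l)
    refine ⟨fun l => ?_, fun l => ?_, fun i j => ?_⟩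
    · simp only [Input.nextVisit_succ]
      refine (h.nextVisit l).add (Measurable.ite (hs l) ?_ measurable_const)
      exact measurable_apply_of_countable
        (f := fun i ω => ∑ j, ((X.input ω).state n).grant (X.input ω) i j + S.overhead i)
        (fun i => (Finset.measurable_sum _ fun j _ => h.grant i j).add measurable_const) h.onu
    · simp only [Input.visits_succ]
      exact (h.visits l).add (Measurable.ite (hs l) measurable_const measurable_const)
    · simp only [Input.granted_succ]
      exact (h.granted i j).add (Measurable.ite (h.onu (measurableSet_singleton i)) (h.grant i j)
        measurable_const)

theorem measurable_visitCount (i : Fin N) (n : ℕ) :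
    Measurable fun ω => (X.input ω).visitCount i n := by
  induction n with
  | zero => simp [Input.visitCount]
  | succ n ih =>
    simp only [Input.visitCount, Nat.count_succ]
    exact ih.add (Measurable.ite ((X.measurableState n).onu (measurableSet_singleton i))
      measurable_const measurable_const)

theorem measurable_started (t : ℝ) : Measurable fun ω => (X.input ω).started t :=
  measurable_sInf_nat fun n => measurableSet_lt measurable_const (X.measurableState n).time

theorem measurable_visitCount_started (i : Fin N) (t : ℝ) :
    Measurable fun ω => (X.input ω).visitCount i ((X.input ω).started t) :=
  measurable_apply_of_countable (X.measurable_visitCount i) (X.measurable_started t)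

theorem aemeasurable_visitTime {i : Fin N} (h : ∀ᵐ ω ∂μ, {n | (X.input ω).onu n = i}.Infinite)
    (k : ℕ) : AEMeasurable (fun ω => (X.input ω).visitTime i k) μ := by
  -- The first `n` whose visit brings the count above `k` is visit `k` of ONU `i`, provided that
  -- there are infinitely many visits, hence almost surely.
  refine ⟨fun ω => (X.input ω).time (sInf {n | k < (X.input ω).visitCount i (n + 1)}),
    measurable_apply_of_countable (fun n => (X.measurableState n).time) (measurable_sInf_nat
      fun n => measurableSet_lt measurable_const (X.measurable_visitCount i (n + 1))), ?_⟩
  filter_upwards [h] with ω hω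
  have he : {n | k < (X.input ω).visitCount i (n + 1)} =
      Set.Ici (Nat.nth (fun n => (X.input ω).onu n = i) k) := by
    ext n
    exact (Nat.lt_nth_iff_count_lt hω).trans Nat.lt_succ_iff
  rw [he, csInf_Ici]
  rfl

end System
end PollingNetwork

/-! ### Tail integrals and convergence in mean -/

theorem ENNReal.ofReal_le_tsum_indicator (z : ℝ) :
    ENNReal.ofReal z ≤ ∑' n : ℕ, if (n : ℝ) < z then 1 else 0 := by
  calc ENNReal.ofReal z ≤ ENNReal.ofReal ⌈z⌉₊ := ENNReal.ofReal_le_ofReal (Nat.le_ceil z)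
    _ = ∑ n ∈ Finset.range ⌈z⌉₊, if (n : ℝ) < z then 1 else 0 := by
      rw [Finset.sum_congr rfl fun n hn => if_pos (Nat.lt_ceil.1 (Finset.mem_range.1 hn))]
      simp
    _ ≤ _ := ENNReal.sum_le_tsum _

theorem lintegral_ofReal_sub_le_tsum {Ω : Type*} [MeasurableSpace Ω] {μ : Measure Ω} {Y : Ω → ℝ}
    (hY : AEMeasurable Y μ) (a : ℝ) :
    ∫⁻ ω, ENNReal.ofReal (Y ω - a) ∂μ ≤ ∑' n : ℕ, μ {ω | a + n < Y ω} := by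
  have hs (n : ℕ) : NullMeasurableSet {ω | a + n < Y ω} μ :=
    nullMeasurableSet_lt aemeasurable_const hY
  calc ∫⁻ ω, ENNReal.ofReal (Y ω - a) ∂μ
      ≤ ∫⁻ ω, ∑' n : ℕ, {ω | a + n < Y ω}.indicator (fun _ => 1) ω ∂μ := by
        refine lintegral_mono fun ω => (ENNReal.ofReal_le_tsum_indicator _).trans_eq ?_
        refine tsum_congr fun n => ?_
        simp only [Set.indicator_apply, Set.mem_ofPred_eq, lt_sub_iff_add_lt']
    _ = ∑' n : ℕ, μ {ω | a + n < Y ω} := by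
        rw [lintegral_tsum fun n => aemeasurable_one.indicator₀ (hs n)]
        exact tsum_congr fun n => lintegral_indicator_one₀ (hs n)

/-- Convergence in measure implies convergence in mean for nonnegative functions with negligible
integrals above some level. -/
theorem tendsto_integral_abs_sub_of_tendstoInMeasure {Ω : Type*} [MeasurableSpace Ω]
    {μ : Measure Ω} [IsProbabilityMeasure μ] {W : ℕ → Ω → ℝ} {a C : ℝ}
    (hW : ∀ m, AEMeasurable (W m) μ) (hW0 : ∀ m, 0 ≤ᵐ[μ] W m) (ha : 0 ≤ a) (hC : 0 ≤ C)
    (h : TendstoInMeasure μ W atTop fun _ => C)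
    (htail : Tendsto (fun m => ∫⁻ ω, ENNReal.ofReal (W m ω - a) ∂μ) atTop (𝓝 0)) :
    Tendsto (fun m => ∫ ω, |W m ω - C| ∂μ) atTop (𝓝 0) := by
  suffices hl : Tendsto (fun m => ∫⁻ ω, ENNReal.ofReal |W m ω - C| ∂μ) atTop (𝓝 0) by
    have h1 := (ENNReal.tendsto_toReal ENNReal.zero_ne_top).comp hl
    refine h1.congr fun m => ?_
    rw [integral_eq_lintegral_of_nonneg_ae (ae_of_all _ fun ω => abs_nonneg _)
      ((hW m).sub_const C).abs.aestronglyMeasurable]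
    rfl
  refine ENNReal.tendsto_nhds_zero.2 fun ε hε => ?_
  rcases eq_or_ne ε ⊤ with rfl | hε'
  · exact Eventually.of_forall fun _ => le_top
  set δ : ℝ := (ε / 2).toReal with hδ
  have hε2 : ε / 2 ≠ ⊤ := ENNReal.div_ne_top hε' two_ne_zero
  have hδ0 : 0 < δ := ENNReal.toReal_pos (ENNReal.half_pos hε.ne').ne' hε2
  have h1 := (ENNReal.Tendsto.const_mul (tendstoInMeasure_iff_norm.1 h δ hδ0)
    (Or.inr (ENNReal.ofReal_ne_top (r := a + C)))).add htail
  rw [mul_zero, add_zero] at h1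
  filter_upwards [ENNReal.tendsto_nhds_zero.1 h1 (ε / 2) (ENNReal.half_pos hε.ne')] with m hm
  have hs : NullMeasurableSet {ω | δ ≤ ‖W m ω - C‖} μ :=
    nullMeasurableSet_le aemeasurable_const ((hW m).sub_const C).norm
  -- Off the set where the deviation reaches `δ`, the first term suffices. On it, `|W - C|` is at
  -- most `a + C` plus the excess of `W` over `a`.
  have hpt : ∀ᵐ ω ∂μ, ENNReal.ofReal |W m ω - C| ≤
      (ENNReal.ofReal δ + {ω | δ ≤ ‖W m ω - C‖}.indicator (fun _ => ENNReal.ofReal (a + C)) ω) +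
        ENNReal.ofReal (W m ω - a) := by
    filter_upwards [hW0 m] with ω hω
    have hω' : 0 ≤ W m ω := hω
    by_cases hc : δ ≤ ‖W m ω - C‖
    · rw [Set.indicator_of_mem (by exact hc), add_assoc]
      refine le_add_left ?_
      rcases le_total (W m ω) a with hle | hle
      · refine le_add_right (ENNReal.ofReal_le_ofReal (abs_le.2 ⟨?_, ?_⟩)) <;> linarith
      · rw [← ENNReal.ofReal_add (by linarith) (by linarith)]
        refine ENNReal.ofReal_le_ofReal (abs_le.2 ⟨?_, ?_⟩) <;> linarith
    · rw [add_assoc]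
      exact le_add_right (ENNReal.ofReal_le_ofReal (not_le.1 hc).le)
  calc ∫⁻ ω, ENNReal.ofReal |W m ω - C| ∂μ ≤ _ := lintegral_mono_ae hpt
    _ = ENNReal.ofReal δ + (ENNReal.ofReal (a + C) * μ {ω | δ ≤ ‖W m ω - C‖} +
        ∫⁻ ω, ENNReal.ofReal (W m ω - a) ∂μ) := by
      rw [lintegral_add_right' _ ((hW m).sub_const a).ennreal_ofReal,
        lintegral_add_left measurable_const, lintegral_const, measure_univ, mul_one,
        lintegral_indicator_const₀ hs, add_assoc]
    _ ≤ ε / 2 + ε / 2 := add_le_add (by rw [hδ, ENNReal.ofReal_toReal hε2]) hm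
    _ = ε := ENNReal.add_halves ε

/-! ### Limits for the random system -/

namespace PollingNetwork.System
variable {N L : ℕ} [NeZero L] {S : PollingNetwork N} {Ω : Type*} [MeasurableSpace Ω]
  {μ : Measure Ω} [IsProbabilityMeasure μ] {X : S.System L μ}

theorem ae_isRegular (h : X.IsPeriodic ∨ X.IsRandom) :
    ∀ᵐ ω ∂μ, (X.input ω).IsRegular X.intensity := by
  have h1 : ∀ᵐ ω ∂μ, ∀ i j, Tendsto (fun t : ℝ => (X.input ω).work i j t / t) atTop
      (𝓝 (X.intensity i j)) :=
    ae_all_iff.2 fun i => ae_all_iff.2 fun j => X.tendsto_work i j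
  have h2 : ∀ᵐ ω ∂μ, ∀ l i, Tendsto (fun n : ℕ => ((X.input ω).routeCount l i n : ℝ) / n) atTop
      (𝓝 (N : ℝ)⁻¹) :=
    ae_all_iff.2 fun l => ae_all_iff.2 fun i => tendsto_routeCount h l i
  filter_upwards [h1, h2] with ω hw hr using ⟨hw, hr⟩

theorem IsStablePathwise.tendsto_backlog (h : X.IsStablePathwise) : ∀ᵐ ω ∂μ, ∀ i j,
    Tendsto (fun t => (X.input ω).backlog i j t / t) atTop (𝓝 0) := by
  refine ae_all_iff.2 fun i => ae_all_iff.2 fun j => ?_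
  filter_upwards [X.tendsto_work i j, h i j] with ω hw hs
  exact Input.tendsto_backlog_div hw hs

/-- In a stable system the backlog is sublinear along some subsequence of any given sequence of
times. -/
theorem exists_subseq_tendsto_backlog (h : X.IsStableInLaw ∨ X.IsStablePathwise) {u : ℕ → ℝ}
    (hu : Tendsto u atTop atTop) : ∃ ns : ℕ → ℕ, StrictMono ns ∧ ∀ᵐ ω ∂μ, ∀ i j,
      Tendsto (fun k => (X.input ω).backlog i j (u (ns k)) / u (ns k)) atTop (𝓝 0) := by
  rcases h with h | h
  -- Collecting the finitely many queues into one vector yields a subsequence that serves them all.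
  · let f : ℕ → Ω → (Σ i, Fin (S.numQueues i)) → ℝ :=
      fun m ω p => (X.input ω).backlog p.1 p.2 (u m) / u m
    have hf : TendstoInMeasure μ f atTop fun _ => 0 := by
      refine tendstoInMeasure_iff_norm.2 fun ε hε => ?_
      have hp (p : Σ i, Fin (S.numQueues i)) :
          Tendsto (fun m => μ {ω | ε ≤ ‖f m ω p‖}) atTop (𝓝 0) := by
        refine ENNReal.tendsto_nhds_zero.2 fun η hη => ?_
        obtain ⟨K, hK⟩ := h p.1 p.2 η hη
        filter_upwards [hu.eventually hK, hu.eventually_gt_atTop 0,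
          hu.eventually_gt_atTop (K / ε)] with m h1 h2 h3
        refine (measure_mono fun ω hω => ?_).trans h1
        have hb := (X.input ω).backlog_nonneg h2.le p.1 p.2
        have hω' : ε ≤ ‖(X.input ω).backlog p.1 p.2 (u m) / u m‖ := hω
        rw [Real.norm_of_nonneg (div_nonneg hb h2.le), le_div_iff₀ h2] at hω'
        rw [div_lt_iff₀ hε] at h3
        exact (h3.trans_le (by linarith)).trans_le ((X.input ω).backlog_le_content p.1 p.2 (u m))
      have hsum := tendsto_finsetSum Finset.univ fun p _ => hp p
      rw [Finset.sum_const_zero] at hsum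
      refine tendsto_of_tendsto_of_tendsto_of_le_of_le tendsto_const_nhds hsum
        (fun _ => zero_le) fun m => ?_
      refine (measure_mono fun ω hω => ?_).trans (measure_biUnion_finset_le Finset.univ _)
      by_contra hcon
      simp only [Set.mem_iUnion, Finset.mem_univ, Set.mem_ofPred_eq, not_exists, not_le,
        forall_const] at hcon
      have hω' : ε ≤ ‖f m ω - 0‖ := hω
      rw [sub_zero] at hω'
      exact ((pi_norm_lt_iff hε).2 hcon).not_ge hω'
    obtain ⟨ns, hns, hlim⟩ := hf.exists_seq_tendsto_ae
    refine ⟨ns, hns, ?_⟩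
    filter_upwards [hlim] with ω hω i j
    exact (tendsto_pi_nhds.1 hω) ⟨i, j⟩
  · refine ⟨id, strictMono_id, ?_⟩
    filter_upwards [h.tendsto_backlog] with ω hω i j
    exact (hω i j).comp hu

/-- Both sides are deterministic, so one realization with sublinear backlog along one sequence of
times decides. -/
theorem load_lt (hpolling : X.IsPeriodic ∨ X.IsRandom)
    (hstable : X.IsStableInLaw ∨ X.IsStablePathwise) : X.load < L := by
  obtain ⟨ns, hns, h⟩ := exists_subseq_tendsto_backlog hstable tendsto_natCast_atTop_atTop
  obtain ⟨ω, hx, hω⟩ := ((ae_isRegular hpolling).and h).exists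
  exact hx.sum_lt (F := map (fun k => (ns k : ℝ)) atTop)
    (tendsto_natCast_atTop_atTop.comp hns.tendsto_atTop) fun i j => tendsto_map'_iff.2 (hω i j)

variable (X) in
/-- The limiting rate of visits to each ONU. -/
def visitRate : ℝ := (L - X.load) / ∑ h, S.overhead h

theorem inv_visitRate : X.visitRate⁻¹ = (∑ h, S.overhead h) / (L - X.load) := inv_div _ _

theorem visitRate_pos (hpolling : X.IsPeriodic ∨ X.IsRandom)
    (hstable : X.IsStableInLaw ∨ X.IsStablePathwise) : 0 < X.visitRate := by
  obtain ⟨ω⟩ : Nonempty Ω := nonempty_of_isProbabilityMeasure μ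
  exact div_pos (sub_pos.2 (load_lt hpolling hstable)) (X.input ω).sum_overhead_pos

/-- Convergence in measure means that every subsequence has a further one converging almost surely;
the pathwise limit is applied along the latter. -/
theorem tendstoInMeasure_visitCount (hpolling : X.IsPeriodic ∨ X.IsRandom)
    (hstable : X.IsStableInLaw ∨ X.IsStablePathwise) (i : Fin N) {b : ℝ} (hb : 0 < b) :
    TendstoInMeasure μ (fun (m : ℕ) ω =>
      ((X.input ω).visitCount i ((X.input ω).started (b * m)) : ℝ) / (b * m)) atTop
      fun _ => X.visitRate := by
  have hu : Tendsto (fun m : ℕ => b * (m : ℝ)) atTop atTop :=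
    tendsto_natCast_atTop_atTop.const_mul_atTop hb
  refine (exists_seq_tendstoInMeasure_atTop_iff fun m =>
    ((measurable_of_countable (Nat.cast : ℕ → ℝ)).comp
      (X.measurable_visitCount_started i (b * m))).div_const _ |>.aestronglyMeasurable).2
    fun ns hns => ?_
  have hu' := hu.comp hns.tendsto_atTop
  obtain ⟨ns', hns', h⟩ := exists_subseq_tendsto_backlog hstable hu'
  refine ⟨ns', hns', ?_⟩
  filter_upwards [ae_isRegular hpolling, h] with ω hx hω
  exact (hx.tendsto_visitCount (F := map (fun k => b * (ns (ns' k) : ℝ)) atTop)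
    (hu'.comp hns'.tendsto_atTop) (fun i j => tendsto_map'_iff.2 (hω i j)) i).comp tendsto_map

theorem ae_infinite_visits (hpolling : X.IsPeriodic ∨ X.IsRandom) (i : Fin N) :
    ∀ᵐ ω ∂μ, {n | (X.input ω).onu n = i}.Infinite := by
  filter_upwards [ae_isRegular hpolling] with ω hω using hω.infinite_visits i

/-- Pathwise inversion would need the visit rate along all times. Here two deterministic times `a *
m` and `b * m` with `a < c⁻¹ < b` suffice: an early or late visit `m` forces a deviation of the
count at one of them. -/
theorem tendstoInMeasure_visitTime_div (hpolling : X.IsPeriodic ∨ X.IsRandom)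
    (hstable : X.IsStableInLaw ∨ X.IsStablePathwise) (i : Fin N) :
    TendstoInMeasure μ (fun (m : ℕ) ω => (X.input ω).visitTime i m / m) atTop
      fun _ => X.visitRate⁻¹ := by
  have hc := visitRate_pos hpolling hstable
  set c := X.visitRate
  refine tendstoInMeasure_iff_norm.2 fun ε hε => ?_
  obtain ⟨a, ha1, ha2⟩ := exists_between (max_lt (sub_lt_self c⁻¹ hε) (inv_pos.2 hc))
  obtain ⟨ha1, ha0⟩ := max_lt_iff.1 ha1
  obtain ⟨b, hb1, hb2⟩ := exists_between (lt_add_of_pos_right c⁻¹ hε)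
  have hb0 : 0 < b := (inv_pos.2 hc).trans hb1
  have hca : c < a⁻¹ := (lt_inv_comm₀ ha0 hc).1 ha2
  have hcb : b⁻¹ < c := inv_lt_of_inv_lt₀ hc hb1
  have h := (tendstoInMeasure_iff_norm.1 (tendstoInMeasure_visitCount hpolling hstable i ha0)
      (a⁻¹ - c) (sub_pos.2 hca)).add
    (tendstoInMeasure_iff_norm.1 (tendstoInMeasure_visitCount hpolling hstable i hb0)
      (c - b⁻¹) (sub_pos.2 hcb))
  rw [add_zero] at h
  refine tendsto_of_tendsto_of_tendsto_of_le_of_le' tendsto_const_nhds h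
    (Eventually.of_forall fun _ => zero_le) ?_
  filter_upwards [eventually_gt_atTop 0] with m hm
  have hm' : (0 : ℝ) < m := by exact_mod_cast hm
  refine (measure_mono_ae ?_).trans (measure_union_le _ _)
  filter_upwards [ae_infinite_visits hpolling i] with ω hi hω
  have hω' : ε ≤ |(X.input ω).visitTime i m / m - c⁻¹| := hω
  rcases le_abs'.1 hω' with h1 | h1
  · left
    have h2 : (X.input ω).visitTime i m ≤ a * m := by
      rw [← div_le_iff₀ hm']; linarith
    have h3 : m < (X.input ω).visitCount i ((X.input ω).started (a * m)) :=
      not_le.1 fun hle => ((X.input ω).lt_visitTime_of_visitCount_le hi hle).not_ge h2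
    have h4 : a⁻¹ < (X.input ω).visitCount i ((X.input ω).started (a * m)) / (a * m) := by
      rw [lt_div_iff₀ (by positivity), inv_mul_cancel_left₀ ha0.ne']
      exact_mod_cast h3
    exact (sub_le_sub_right h4.le c).trans (le_abs_self _)
  · right
    have h2 : b * m < (X.input ω).visitTime i m := by
      rw [← lt_div_iff₀ hm']; linarith
    have h3 : (X.input ω).visitCount i ((X.input ω).started (b * m)) ≤ m :=
      not_lt.1 fun hlt => ((X.input ω).visitTime_le_of_lt_visitCount hlt).not_gt h2
    have h4 : (X.input ω).visitCount i ((X.input ω).started (b * m)) / (b * m) ≤ b⁻¹ := by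
      rw [div_le_iff₀ (by positivity), inv_mul_cancel_left₀ hb0.ne']
      exact_mod_cast h3
    refine (sub_le_sub_left h4 c).trans ?_
    rw [← neg_sub]
    exact neg_le_abs _

theorem meanGap_eq (i : Fin N) (m : ℕ) (ω : Ω) :
    X.meanGap i m ω = (X.input ω).visitTime i m / m - (X.input ω).visitTime i 0 / m := by
  rw [← sub_div, ← Finset.sum_range_sub]
  rfl

theorem tendsto_meanGap {i : Fin N} {ω : Ω} {C : ℝ} {ns : ℕ → ℕ} (hns : Tendsto ns atTop atTop)
    (h : Tendsto (fun k => (X.input ω).visitTime i (ns k) / ns k) atTop (𝓝 C)) :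
    Tendsto (fun k => X.meanGap i (ns k) ω) atTop (𝓝 C) := by
  have h1 := h.sub ((tendsto_const_div_atTop_nhds_zero_nat
    ((X.input ω).visitTime i 0)).comp hns)
  rw [sub_zero] at h1
  exact h1.congr fun k => (meanGap_eq i (ns k) ω).symm

theorem aemeasurable_visitTime_div (hpolling : X.IsPeriodic ∨ X.IsRandom) (i : Fin N) (m k : ℕ) :
    AEMeasurable (fun ω => (X.input ω).visitTime i m / k) μ :=
  (X.aemeasurable_visitTime (ae_infinite_visits hpolling i) m).div_const _

theorem aemeasurable_meanGap (hpolling : X.IsPeriodic ∨ X.IsRandom) (i : Fin N) (m : ℕ) :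
    AEMeasurable (X.meanGap i m) μ := by
  rw [show X.meanGap i m = _ from funext (meanGap_eq i m)]
  exact (aemeasurable_visitTime_div hpolling i m m).sub
    (aemeasurable_visitTime_div hpolling i 0 m)

theorem tendstoInMeasure_meanGap (hpolling : X.IsPeriodic ∨ X.IsRandom)
    (hstable : X.IsStableInLaw ∨ X.IsStablePathwise) (i : Fin N) :
    TendstoInMeasure μ (X.meanGap i) atTop fun _ => X.visitRate⁻¹ := by
  refine (exists_seq_tendstoInMeasure_atTop_iff fun m =>
    (aemeasurable_meanGap hpolling i m).aestronglyMeasurable).2 fun ns hns => ?_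
  obtain ⟨ns', hns', h⟩ := (exists_seq_tendstoInMeasure_atTop_iff fun m =>
    (aemeasurable_visitTime_div hpolling i m m).aestronglyMeasurable).1
    (tendstoInMeasure_visitTime_div hpolling hstable i) ns hns
  refine ⟨ns', hns', ?_⟩
  filter_upwards [h] with ω hω
  exact tendsto_meanGap (hns.comp hns').tendsto_atTop hω

/-- The first `m` times between successive visits to an ONU are unlikely to take much more than a
fixed number of visit durations each. -/
theorem exists_lintegral_visitTime_le (hpolling : X.IsPeriodic ∨ X.IsRandom) : ∃ K B q : ℝ,
    0 < K ∧ 0 < B ∧ 0 < q ∧ q < 1 ∧ ∀ i (m n : ℕ),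
      ∫⁻ ω, ENNReal.ofReal (((X.input ω).visitTime i m - (X.input ω).visitTime i 0) /
        S.maxDuration - n) ∂μ ≤ ENNReal.ofReal (K * B ^ m * q ^ n) := by
  obtain ⟨A, B, q, hA, hB, hq0, hq1, h⟩ := exists_routeCount_tail_bound hpolling
  have hL : (0 : ℝ) < L := by exact_mod_cast Nat.pos_of_ne_zero (NeZero.ne L)
  have hq1' : 0 < 1 - q := sub_pos.2 hq1
  -- The factor `L` comes from a union bound over the wavelengths, `(1 - q)⁻¹` from the geometric
  -- sum of the tails.
  refine ⟨L * A * (1 - q)⁻¹, B, q, by positivity, hB, hq0, hq1, fun i m n => ?_⟩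
  have hT := fun k => X.aemeasurable_visitTime (ae_infinite_visits hpolling i) k
  refine (lintegral_ofReal_sub_le_tsum (((hT m).sub (hT 0)).div_const _) n).trans ?_
  have hk (k : ℕ) : μ {ω | n + (k : ℝ) <
      ((X.input ω).visitTime i m - (X.input ω).visitTime i 0) / S.maxDuration} ≤
      ENNReal.ofReal (L * A * B ^ m * q ^ n * q ^ k) := by
    have hsub : {ω | n + (k : ℝ) < ((X.input ω).visitTime i m - (X.input ω).visitTime i 0) /
        S.maxDuration} ⊆ ⋃ l, {ω | (X.input ω).routeCount l i (n + k) ≤ m} := by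
      intro ω hω
      by_contra hcon
      simp only [Set.mem_iUnion, Set.mem_ofPred_eq, not_exists, not_le] at hcon
      have h1 := (X.input ω).visitTime_le hcon
      have h2 : (X.input ω).time 0 ≤ (X.input ω).visitTime i 0 :=
        (X.input ω).monotone_time (Nat.zero_le _)
      have h3 := S.maxDuration_pos i
      have hω' : n + (k : ℝ) < ((X.input ω).visitTime i m - (X.input ω).visitTime i 0) /
        S.maxDuration := hω
      rw [lt_div_iff₀ h3] at hω'
      push_cast at h1
      linarith
    refine (measure_mono hsub).trans ((measure_iUnion_fintype_le _ _).trans ?_)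
    calc ∑ l, μ {ω | (X.input ω).routeCount l i (n + k) ≤ m}
        ≤ ∑ _l : Fin L, ENNReal.ofReal (A * B ^ m * q ^ (n + k)) :=
          Finset.sum_le_sum fun l _ => by
            rw [← ofReal_measureReal]
            exact ENNReal.ofReal_le_ofReal (h l i m (n + k))
      _ = ENNReal.ofReal (L * A * B ^ m * q ^ n * q ^ k) := by
          rw [Finset.sum_const, Finset.card_univ, Fintype.card_fin, nsmul_eq_mul,
            ← ENNReal.ofReal_natCast, ← ENNReal.ofReal_mul L.cast_nonneg, pow_add]
          ring_nf
  refine (ENNReal.tsum_le_tsum hk).trans_eq ?_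
  rw [← ENNReal.ofReal_tsum_of_nonneg (fun k => by positivity)
    ((summable_geometric_of_lt_one hq0.le hq1).mul_left _), tsum_mul_left,
    tsum_geometric_of_lt_one hq0.le hq1]
  ring_nf

/-- The start times of the wavelengths are arbitrary, so only differences of visit times need be
integrable. -/
theorem integrable_visitTime_sub (hpolling : X.IsPeriodic ∨ X.IsRandom) (i : Fin N) (m : ℕ) :
    Integrable (fun ω => (X.input ω).visitTime i m - (X.input ω).visitTime i 0) μ := by
  obtain ⟨K, B, q, -, -, -, -, h⟩ := exists_lintegral_visitTime_le hpolling
  have hT := fun k => X.aemeasurable_visitTime (ae_infinite_visits hpolling i) k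
  have hD := S.maxDuration_pos i
  have h1 : Integrable (fun ω => ((X.input ω).visitTime i m - (X.input ω).visitTime i 0) /
      S.maxDuration) μ := by
    refine ⟨(((hT m).sub (hT 0)).div_const _).aestronglyMeasurable, ?_⟩
    rw [hasFiniteIntegral_iff_ofReal]
    · refine lt_of_le_of_lt ?_ (ENNReal.ofReal_lt_top (r := K * B ^ m * q ^ 0))
      simpa using h i m 0
    · filter_upwards [ae_infinite_visits hpolling i] with ω hi
      exact div_nonneg (sub_nonneg.2 ((X.input ω).monotone_visitTime hi (Nat.zero_le m))) hD.le
  refine (h1.mul_const S.maxDuration).congr (ae_of_all _ fun ω => ?_)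
  exact div_mul_cancel₀ _ hD.ne'

theorem integrable_gap (hpolling : X.IsPeriodic ∨ X.IsRandom) (i : Fin N) (k : ℕ) :
    Integrable (fun ω => (X.input ω).gap i k) μ := by
  refine ((integrable_visitTime_sub hpolling i (k + 1)).sub
    (integrable_visitTime_sub hpolling i k)).congr (ae_of_all _ fun ω => ?_)
  simp [Input.gap]

theorem tendsto_integral_abs_meanGap_sub (hpolling : X.IsPeriodic ∨ X.IsRandom)
    (hstable : X.IsStableInLaw ∨ X.IsStablePathwise) (i : Fin N) :
    Tendsto (fun m => ∫ ω, |X.meanGap i m ω - X.visitRate⁻¹| ∂μ) atTop (𝓝 0) := by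
  obtain ⟨K, B, q, hK, hB, hq0, hq1, h⟩ := exists_lintegral_visitTime_le hpolling
  have hD := S.maxDuration_pos i
  -- With `n * m` visit durations allowed for `m` gaps, the tail bound `K * B ^ m * q ^ (n * m)` is
  -- at most `K / 2 ^ m`.
  obtain ⟨n, hn⟩ := exists_pow_lt_of_lt_one (show (0 : ℝ) < (2 * B)⁻¹ by positivity) hq1
  have hBq : B * q ^ n ≤ 1 / 2 := by
    have := (mul_lt_mul_of_pos_left hn hB).le
    rwa [mul_inv, mul_left_comm, mul_inv_cancel₀ hB.ne', mul_one, ← one_div] at this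
  refine tendsto_integral_abs_sub_of_tendstoInMeasure (a := S.maxDuration * n)
    (fun m => aemeasurable_meanGap hpolling i m) (fun m => ?_) (by positivity)
    (inv_pos.2 (visitRate_pos hpolling hstable)).le (tendstoInMeasure_meanGap hpolling hstable i) ?_
  · filter_upwards [ae_infinite_visits hpolling i] with ω hi
    rw [meanGap_eq, ← sub_div]
    exact div_nonneg (sub_nonneg.2 ((X.input ω).monotone_visitTime hi (Nat.zero_le m)))
      m.cast_nonneg
  · have hlim : Tendsto (fun m : ℕ => ENNReal.ofReal S.maxDuration *
        ENNReal.ofReal (K * (1 / 2) ^ m)) atTop (𝓝 0) := by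
      have h1 : Tendsto (fun m : ℕ => K * (1 / 2 : ℝ) ^ m) atTop (𝓝 (K * 0)) :=
        (tendsto_pow_atTop_nhds_zero_of_lt_one (by norm_num) (by norm_num)).const_mul K
      have h2 := ENNReal.Tendsto.const_mul (ENNReal.tendsto_ofReal h1)
        (Or.inr (ENNReal.ofReal_ne_top (r := S.maxDuration)))
      simpa using h2
    refine tendsto_of_tendsto_of_tendsto_of_le_of_le' tendsto_const_nhds hlim
      (Eventually.of_forall fun _ => zero_le) ?_
    filter_upwards [eventually_gt_atTop 0] with m hm
    have hm1 : (1 : ℝ) ≤ m := by exact_mod_cast hm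
    have hm' : (0 : ℝ) < m := by linarith
    have hle : ∫⁻ ω, ENNReal.ofReal (((X.input ω).visitTime i m - (X.input ω).visitTime i 0) /
        S.maxDuration - (n * m : ℕ)) ∂μ ≤ ENNReal.ofReal (K * (1 / 2) ^ m) := by
      refine (h i m (n * m)).trans (ENNReal.ofReal_le_ofReal ?_)
      rw [pow_mul, mul_assoc, ← mul_pow]
      gcongr
    refine le_trans ?_ (mul_le_mul_right hle _)
    rw [← lintegral_const_mul' _ _ ENNReal.ofReal_ne_top]
    refine lintegral_mono fun ω => ?_
    rw [meanGap_eq, ← sub_div, ← ENNReal.ofReal_mul hD.le]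
    set y := (X.input ω).visitTime i m - (X.input ω).visitTime i 0
    have he : S.maxDuration * (y / S.maxDuration - (n * m : ℕ)) =
        m * (y / m - S.maxDuration * n) := by
      push_cast; field_simp
    rw [he, ENNReal.ofReal_mul hm'.le]
    -- Passing from the total to the average would gain a factor `1 / m`, which is not needed.
    exact le_mul_of_one_le_left' (by simpa using ENNReal.ofReal_le_ofReal hm1)

/-- All averages with `m > 0` have the same mean as the first gap, and convergence in `L¹` carries
over to means. -/
theorem integral_gap_zero (hpolling : X.IsPeriodic ∨ X.IsRandom)
    (hstable : X.IsStableInLaw ∨ X.IsStablePathwise) (i : Fin N)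
    (h : ∀ k, IdentDistrib (fun ω => (X.input ω).gap i k) (fun ω => (X.input ω).gap i 0) μ μ) :
    ∫ ω, (X.input ω).gap i 0 ∂μ = X.visitRate⁻¹ := by
  have hint (m : ℕ) : Integrable (X.meanGap i m) μ :=
    (integrable_finsetSum _ fun k _ => integrable_gap hpolling i k).div_const _
  refine tendsto_nhds_unique (l := atTop) (f := fun _ : ℕ => ∫ ω, (X.input ω).gap i 0 ∂μ)
    tendsto_const_nhds ?_
  rw [tendsto_iff_norm_sub_tendsto_zero]
  refine squeeze_zero' (Eventually.of_forall fun m => norm_nonneg _) ?_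
    (tendsto_integral_abs_meanGap_sub hpolling hstable i)
  filter_upwards [eventually_gt_atTop 0] with m hm
  have hm' : (m : ℝ) ≠ 0 := by exact_mod_cast hm.ne'
  have he : ∫ ω, (X.input ω).gap i 0 ∂μ = ∫ ω, X.meanGap i m ω ∂μ := by
    simp only [meanGap]
    rw [integral_div, integral_finsetSum _ fun k _ => integrable_gap hpolling i k,
      Finset.sum_congr rfl fun k _ => (h k).integral_eq, Finset.sum_const, Finset.card_range,
      nsmul_eq_mul, mul_div_cancel_left₀ _ hm']
  have he' : ∫ ω, X.meanGap i m ω ∂μ - X.visitRate⁻¹ =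
      ∫ ω, (X.meanGap i m ω - X.visitRate⁻¹) ∂μ := by
    rw [integral_sub (hint m) (integrable_const _)]; simp
  rw [he, he']
  exact norm_integral_le_integral_norm _

theorem ae_tendsto_meanGap (hpolling : X.IsPeriodic ∨ X.IsRandom) (hstable : X.IsStablePathwise)
    (i : Fin N) : ∀ᵐ ω ∂μ, Tendsto (fun m => X.meanGap i m ω) atTop (𝓝 X.visitRate⁻¹) := by
  filter_upwards [ae_isRegular hpolling, hstable.tendsto_backlog] with ω hx hb
  exact tendsto_meanGap tendsto_id (Input.tendsto_visitTime_div
    (visitRate_pos hpolling (Or.inr hstable)) (hx.infinite_visits i)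
    (hx.tendsto_visitCount le_rfl hb i))

end PollingNetwork.System

end

theorem mainTheorem8 {N L : ℕ} [NeZero L] (S : PollingNetwork N) {Ω : Type*} [MeasurableSpace Ω]
    (μ : Measure Ω) [IsProbabilityMeasure μ] (X : S.System L μ)
    (hpolling : X.IsPeriodic ∨ X.IsRandom)
    (hstable : X.IsStableInLaw ∨ X.IsStablePathwise) :
    X.load < L ∧
    ∀ i : Fin N,
      (∀ k, Integrable (fun ω => (X.input ω).gap i k) μ) ∧
      Tendsto (fun m => ∫ ω, |X.meanGap i m ω - (∑ h, S.overhead h) / (L - X.load)| ∂μ)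
        atTop (𝓝 0) ∧
      ((∀ k, IdentDistrib (fun ω => (X.input ω).gap i k) (fun ω => (X.input ω).gap i 0) μ μ) →
        ∫ ω, (X.input ω).gap i 0 ∂μ = (∑ h, S.overhead h) / (L - X.load)) ∧
      (X.IsStablePathwise →
        ∀ᵐ ω ∂μ, Tendsto (fun m => X.meanGap i m ω) atTop
          (𝓝 ((∑ h, S.overhead h) / (L - X.load)))) := by
  rw [← PollingNetwork.System.inv_visitRate]
  refine ⟨PollingNetwork.System.load_lt hpolling hstable, fun i =>
    ⟨PollingNetwork.System.integrable_gap hpolling i,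
    PollingNetwork.System.tendsto_integral_abs_meanGap_sub hpolling hstable i,
    PollingNetwork.System.integral_gap_zero hpolling hstable i,
    fun hpath => PollingNetwork.System.ae_tendsto_meanGap hpolling hpath i⟩⟩
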